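/- **Setting.** Consider the transport equation $\partial_t v+\boldsymbol\omega\cdot\nabla v=0$, $v(0,\cdot)=v_0$, in $\mathbb R^2$ with constant velocity $\boldsymbol\omega=(\omega_x,\omega_y)$ and 1-periodic (in each variable) complex-valued $v_0$; its solution is $v(t,\mathbf r)=v_0(\mathbf r-\boldsymbol\omega t)$. *Mesh.* For $h=1/N$, $N\in\mathbb N$, $N\ge 1$, let the mesh nodes be $(mh,nh)$, $m,n\in\mathbb Z$. Each cell $[\eta_xh,(\eta_x+1)h]\times[\eta_yh,(\eta_y+1)h]$, $\boldsymbol\eta\in\mathbb Z^2$, is cut into a lower-left and an upper-right triangle by the diagonal joining its lower right and upper left corners. A mesh function is a family $u=\{u_e\}$ of polynomials of degree at most $1$ with complex coefficients, one for each triangle $e$, periodic with the periodic cell $(0,1)^2$. It is represented by the vectors $u_{\boldsymbol\eta}\in\mathbb C^6$ of its values at the vertices of the two triangles of each cell, and $\|u\|^2=\sum_{\boldsymbol\eta\in\{1,\dots,N\}^2}h^2\|u_{\boldsymbol\eta}\|^2$ with the Euclidean norm on $\mathbb C^6$. The Lagrangian mapping $\Pi_h$ takes a continuous function to the mesh function with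 the same values at the vertices of each triangle. *Scheme.* Choose two distinct collocation points in the relative interior of each mesh edge (for instance the Gauss–Legendre points), in the same relative positions on all parallel edges. For a mesh function $u$ and a triangle $e$ let $\mathbf f_e[u]$ be the element of $RT_1=P_1^2+(x,y)^TP_1$ ($P_1$ is the space of polynomials of degree at most $1$) such that $\mathbf f_e[u](\mathbf r_0)=\boldsymbol\omega\,u_e(\mathbf r_0)$ at the mass center $\mathbf r_0$ of $e$ and, at both collocation points $\mathbf r$ of each edge of $e$ with unit normal $\mathbf n$, $\mathbf f_e[u](\mathbf r)\cdot\mathbf n=(\boldsymbol\omega\cdot\mathbf n)\,u(\mathbf r+0\mathbf n)$ if $\boldsymbol\omega\cdot\mathbf n<0$ and $\mathbf f_e[u](\mathbf r)\cdot\mathbf n=(\boldsymbol\omega\cdot\mathbf n)\,u(\mathbf r-0\mathbf n)$ if $\boldsymbol\omega\cdot\mathbf n\ge0$. The SD-RT(1) scheme is the system $\partial_tu_e+\operatorname{div}\mathbf f_e[u]=0$ for all triangles $e$, $t\ge0$, with $u(t)$ a (periodic) mesh function. *Order of accuracy.* For real $q\ge0$ the scheme has order $q$ if for each 1-periodic $v_0\in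 C^{\lceil q\rceil+1}(\mathbb R^2)$ there are constants $c_1,c_2$, depending on $v_0$ (and on $\boldsymbol\omega$) but not on $h$ and $t$, such that the solution $u$ of the scheme with $u(0)=\Pi_hv_0$ satisfies $\|u(t)-\Pi_hv(t,\cdot)\|\le(c_1+c_2t)h^q$ for all $h=1/N$ and all $t\ge0$. The optimal order of accuracy is the maximal $q$ such that the scheme has order $q$. **Theorem.** Let $\omega_x>0$ and $\omega_y\ge0$. For each $h=1/N$ and each initial mesh function the SD-RT(1) scheme has exactly one solution on $[0,\infty)$, and: 1. if $\omega_y>0$, the optimal order of accuracy of the scheme is $2$; 2. if $\omega_y=0$ (the velocity is parallel to a family of mesh edges), the optimal order of accuracy of the scheme is $1$. -/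

import Mathlib

noncomputable section

namespace SDRT

/-! ### The space `RT₁` -/

/-- Polynomials of two real variables of degree at most one, with complex coefficients. -/
def IsP1 (p : ℝ × ℝ → ℂ) : Prop :=
  ∃ a b c : ℂ, ∀ r : ℝ × ℝ, p r = a + b * r.1 + c * r.2

/-- Membership in the Raviart-Thomas space `RT₁ = P₁² + (x, y)ᵀ P₁`. -/
def IsRT1 (f : ℝ × ℝ → ℂ × ℂ) : Prop :=
  ∃ p₁ p₂ p₀ : ℝ × ℝ → ℂ, IsP1 p₁ ∧ IsP1 p₂ ∧ IsP1 p₀ ∧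
    ∀ r : ℝ × ℝ, f r = (p₁ r + r.1 * p₀ r, p₂ r + r.2 * p₀ r)

/-- The divergence of a vector field on the plane. -/
def divergence (f : ℝ × ℝ → ℂ × ℂ) (r : ℝ × ℝ) : ℂ :=
  deriv (fun x : ℝ => (f (x, r.2)).1) r.1 + deriv (fun y : ℝ => (f (r.1, y)).2) r.2

/-! ### The right-triangular mesh

The mesh nodes are `(m h, n h)`. The cell `η` is the square
`[η₁ h, (η₁ + 1) h] × [η₂ h, (η₂ + 1) h]`; its diagonal from the lower right to the upper left
corner cuts it into two triangles. -/

/-- The two triangles of a cell: `lower` contains the corner `(0, 0)` of the (scaled) cell,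
`upper` contains the corner `(1, 1)`. -/
inductive Half
  | lower
  | upper

/-- The three families of parallel mesh edges. Each triangle has one edge of each family. -/
inductive EdgeFamily
  | horizontal
  | vertical
  | diagonal

/-- The vertices of the two triangles of a cell, relative to the cell and for `h = 1`:
indices `0, 1, 2` are the vertices of `lower`, indices `3, 4, 5` are those of `upper`. -/
def corner : Fin 6 → ℝ × ℝ :=
  ![(0, 0), (1, 0), (0, 1), (0, 1), (1, 1), (1, 0)]

/-- The point of the plane with the coordinates `a` relative to the cell `η`. -/
def cellPoint (h : ℝ) (η : ℤ × ℤ) (a : ℝ × ℝ) : ℝ × ℝ :=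
  ((η.1 + a.1) * h, (η.2 + a.2) * h)

/-- The mass center of a triangle, relative to the cell. -/
def massCenter : Half → ℝ × ℝ
  | .lower => (1 / 3, 1 / 3)
  | .upper => (2 / 3, 2 / 3)

/-- The point with parameter `s ∈ [0, 1]` on an edge of a triangle, relative to the cell.
Parallel edges are parametrized in the same direction. -/
def edgePoint (s : ℝ) : Half → EdgeFamily → ℝ × ℝ
  | .lower, .horizontal => (s, 0)
  | .lower, .vertical => (0, s)
  | .lower, .diagonal => (1 - s, s)
  | .upper, .horizontal => (s, 1)
  | .upper, .vertical => (1, s)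
  | .upper, .diagonal => (1 - s, s)

/-- The outward unit normal vector to an edge of a triangle. -/
def outwardNormal : Half → EdgeFamily → ℝ × ℝ
  | .lower, .horizontal => (0, -1)
  | .lower, .vertical => (-1, 0)
  | .lower, .diagonal => (1 / √2, 1 / √2)
  | .upper, .horizontal => (0, 1)
  | .upper, .vertical => (1, 0)
  | .upper, .diagonal => (-(1 / √2), -(1 / √2))

/-- The cell of the triangle that shares with the triangle `T` of the cell `η` the edge of the
family `E`. -/
def neighborCell (η : ℤ × ℤ) : Half → EdgeFamily → ℤ × ℤ
  | .lower, .horizontal => (η.1, η.2 - 1)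
  | .lower, .vertical => (η.1 - 1, η.2)
  | .lower, .diagonal => η
  | .upper, .horizontal => (η.1, η.2 + 1)
  | .upper, .vertical => (η.1 + 1, η.2)
  | .upper, .diagonal => η

/-- Any two triangles that share an edge are of different kinds. -/
def Half.other : Half → Half
  | .lower => .upper
  | .upper => .lower

/-! ### Mesh functions -/

/-- A piecewise linear, generally discontinuous function, represented by its values at the
vertices of the triangles. -/
abbrev MeshFun : Type := ℤ × ℤ → Fin 6 → ℂ

/-- The linear polynomial `u_e` on the triangle `e = (η, T)` that has the values of `u` at the
three vertices of `e`. -/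
def MeshFun.poly (h : ℝ) (u : MeshFun) (η : ℤ × ℤ) (T : Half) (r : ℝ × ℝ) : ℂ :=
  let x : ℂ := ((r.1 / h - η.1 : ℝ) : ℂ)
  let y : ℂ := ((r.2 / h - η.2 : ℝ) : ℂ)
  match T with
  | .lower => u η 0 + (u η 1 - u η 0) * x + (u η 2 - u η 0) * y
  | .upper => u η 4 + (u η 3 - u η 4) * (1 - x) + (u η 5 - u η 4) * (1 - y)

/-- Periodicity with the periodic cell `(0, 1)²` of a mesh function on the mesh with the step
`1 / N`. -/
def MeshFun.IsPeriodic (N : ℕ) (u : MeshFun) : Prop :=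
  ∀ η : ℤ × ℤ, u (η.1 + N, η.2) = u η ∧ u (η.1, η.2 + N) = u η

/-- The norm of a mesh function on the mesh with the step `1 / N`. -/
def MeshFun.meshNorm (N : ℕ) (u : MeshFun) : ℝ :=
  √(∑ i ∈ Finset.Icc (1 : ℤ) N, ∑ j ∈ Finset.Icc (1 : ℤ) N,
    (1 / (N : ℝ)) ^ 2 * ∑ ξ : Fin 6, ‖u (i, j) ξ‖ ^ 2)

/-- The Lagrangian mapping `Π_h`. -/
def lagrange (h : ℝ) (v : ℝ × ℝ → ℂ) : MeshFun :=
  fun η ξ => v (cellPoint h η (corner ξ))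

/-! ### The scheme SD-RT(1) -/

/-- The solution of the Riemann problem at the point `r` of the edge of the family `E` of the
triangle `(η, T)`: `ω · n` times the limit value of `u` at `r` from the upwind side. -/
def riemannFlux (ω : ℝ × ℝ) (h : ℝ) (u : MeshFun) (η : ℤ × ℤ) (T : Half) (E : EdgeFamily)
    (r : ℝ × ℝ) : ℂ :=
  let ωn : ℝ := ω.1 * (outwardNormal T E).1 + ω.2 * (outwardNormal T E).2
  if ωn < 0 then ωn * u.poly h (neighborCell η T E) T.other r else ωn * u.poly h η T r

/-- `f` is the flux `f_e[u]` on the triangle `e = (η, T)`. On each edge of the family `E` there are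
two flux collocation points, with the parameters `s E 0` and `s E 1`; the only interior collocation
point is the mass center. -/
structure IsFlux (ω : ℝ × ℝ) (s : EdgeFamily → Fin 2 → ℝ) (h : ℝ) (u : MeshFun) (η : ℤ × ℤ)
    (T : Half) (f : ℝ × ℝ → ℂ × ℂ) : Prop where
  mem_RT1 : IsRT1 f
  interior : f (cellPoint h η (massCenter T)) =
    (ω.1 * u.poly h η T (cellPoint h η (massCenter T)),
      ω.2 * u.poly h η T (cellPoint h η (massCenter T)))
  edge : ∀ (E : EdgeFamily) (i : Fin 2),
    (f (cellPoint h η (edgePoint (s E i) T E))).1 * (outwardNormal T E).1 +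
      (f (cellPoint h η (edgePoint (s E i) T E))).2 * (outwardNormal T E).2 =
    riemannFlux ω h u η T E (cellPoint h η (edgePoint (s E i) T E))

/-- `u` is a periodic solution, for `t ≥ 0`, of the semidiscrete problem
`∂u_e/∂t + div f_e[u] = 0` on the mesh with the step `1 / N`. -/
def IsSolution (ω : ℝ × ℝ) (s : EdgeFamily → Fin 2 → ℝ) (N : ℕ) (u : ℝ → MeshFun) : Prop :=
  ∀ t : ℝ, 0 ≤ t → (u t).IsPeriodic N ∧
    ∀ (η : ℤ × ℤ) (T : Half), ∃ f : ℝ × ℝ → ℂ × ℂ, IsFlux ω s (1 / N) (u t) η T f ∧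
      ∀ r : ℝ × ℝ, HasDerivWithinAt (fun τ : ℝ => (u τ).poly (1 / N) η T r)
        (-divergence f r) (Set.Ici 0) t

/-- On every mesh and for all periodic initial data the semidiscrete problem has exactly one
solution on `[0, ∞)`. -/
def IsWellPosed (ω : ℝ × ℝ) (s : EdgeFamily → Fin 2 → ℝ) : Prop :=
  ∀ N : ℕ, 0 < N → ∀ u₀ : MeshFun, u₀.IsPeriodic N →
    (∃ u : ℝ → MeshFun, IsSolution ω s N u ∧ u 0 = u₀) ∧
    ∀ u w : ℝ → MeshFun, IsSolution ω s N u → IsSolution ω s N w → u 0 = u₀ → w 0 = u₀ →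
      ∀ t : ℝ, 0 ≤ t → u t = w t

/-! ### Order of accuracy -/

/-- The solution `v(t, r) = v₀(r - ω t)` of the transport equation. -/
def exactSolution (ω : ℝ × ℝ) (v₀ : ℝ × ℝ → ℂ) (t : ℝ) : ℝ × ℝ → ℂ :=
  fun r => v₀ (r.1 - ω.1 * t, r.2 - ω.2 * t)

/-- The scheme has order `q`: for each 1-periodic `v₀` of class `C^{q+1}` the solution error is
bounded by `(c₁ + c₂ t) h^q`, with `c₁`, `c₂` depending on `v₀`. A non-integer `q` is allowed, with
`q + 1` rounded up in the smoothness requirement. -/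
def HasOrder (ω : ℝ × ℝ) (s : EdgeFamily → Fin 2 → ℝ) (q : ℝ) : Prop :=
  ∀ v₀ : ℝ × ℝ → ℂ, ContDiff ℝ ((⌈q⌉₊ + 1 : ℕ) : WithTop ℕ∞) v₀ →
    (∀ r : ℝ × ℝ, v₀ (r.1 + 1, r.2) = v₀ r ∧ v₀ (r.1, r.2 + 1) = v₀ r) →
    ∃ c₁ c₂ : ℝ, ∀ N : ℕ, 0 < N → ∀ u : ℝ → MeshFun, IsSolution ω s N u →
      u 0 = lagrange (1 / N) v₀ →
      ∀ t : ℝ, 0 ≤ t →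
        MeshFun.meshNorm N (u t - lagrange (1 / N) (exactSolution ω v₀ t)) ≤
          (c₁ + c₂ * t) * (1 / (N : ℝ)) ^ q

/-- `p` is the optimal order of accuracy: the maximal `q ≥ 0` such that the scheme has order
`q`. -/
def IsOptimalOrder (ω : ℝ × ℝ) (s : EdgeFamily → Fin 2 → ℝ) (p : ℝ) : Prop :=
  IsGreatest {q : ℝ | 0 ≤ q ∧ HasOrder ω s q} p

end SDRT

end

noncomputable section

namespace SDRT

open Set

/-! The normal trace of an `RT₁` field on an edge is affine, and so is the upwind trace of a mesh
function. Agreement at two distinct points is therefore agreement on the whole edge: the positions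
of the collocation points drop out, and together with the condition at the mass center the eight
coefficients of the flux are determined. The scheme becomes an explicit linear system for the vertex
values, with rate `cellRate` on the unit cell (`isSolution_iff`).

Upper bounds combine stability with consistency. In a weighted `L²` energy the rate of a cell is a
telescoping edge term minus a nonnegative form in the jumps (`energyForm_cellRate_le`), so a source
of size `δ` contributes at most a multiple of `δ t` to the norm (`meshNorm_le_of_hasDeriv`);
uniqueness follows as well. The rate is exact on affine functions, hence the residual of the
interpolated solution is `O(h)`, which gives order 1. Its leading part is a combination of second
derivatives with coefficient vectors that are the same in all cells. If `b > 0`, these vectors lie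
in the range of the rate on data repeated in every cell (`exists_corrector`). Adding `h²` times the
preimage changes the interpolant by `O(h²)` and lowers the residual to `O(h²)`: order 2.

Lower bounds use the mode `exp (2πix)`. If the scheme has order `q`, then a functional `φ` of the
truncation error is at most of size `(κ + ∑ ‖φ ξ‖) h^q`, where `κ` bounds `φ` composed with the
residual operator (`norm_modeResidual_le_of_hasOrder`). The value at one vertex has `κ` of size
`1/h` and truncation error of size `h`, so `q ≤ 2`. If `b = 0`, the horizontal rows of cells
decouple and a further local conservation law appears; for its functional `κ` stays bounded while
the truncation error is still of size `h`, so `q ≤ 1`. -/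

/-! ### The scheme as a system of ordinary differential equations -/

/-- The right-hand side of the scheme on the unit cell: `u` are the values in the cell, `l` and `d`
are the values in the cells to the left of it and below it. -/
def cellRate {K : Type*} [CommRing K] (a b : K) (u l d : Fin 6 → K) : Fin 6 → K :=
  ![-a * (u 1 - u 0) - b * (u 2 - u 0) + 4 * a * (l 5 - u 0) + a * (l 4 - u 2)
      + 4 * b * (d 3 - u 0) + b * (d 4 - u 1),
    -a * (u 1 - u 0) - b * (u 2 - u 0) - 2 * a * (l 5 - u 0) - 2 * a * (l 4 - u 2)
      + b * (d 3 - u 0) + 4 * b * (d 4 - u 1),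
    -a * (u 1 - u 0) - b * (u 2 - u 0) + a * (l 5 - u 0) + 4 * a * (l 4 - u 2)
      - 2 * b * (d 3 - u 0) - 2 * b * (d 4 - u 1),
    -a * (u 4 - u 3) - b * (u 4 - u 5) + 4 * (a + b) * (u 2 - u 3) + (a + b) * (u 1 - u 5),
    -a * (u 4 - u 3) - b * (u 4 - u 5) - 2 * (a + b) * (u 2 - u 3) - 2 * (a + b) * (u 1 - u 5),
    -a * (u 4 - u 3) - b * (u 4 - u 5) + (a + b) * (u 2 - u 3) + 4 * (a + b) * (u 1 - u 5)]

/-- The right-hand side of the scheme. -/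
def meshRate (a b h : ℝ) (u : MeshFun) : MeshFun := fun η ξ =>
  (h : ℂ)⁻¹ * cellRate (a : ℂ) (b : ℂ) (u η) (u (η.1 - 1, η.2)) (u (η.1, η.2 - 1)) ξ

lemma poly_lower_cellPoint {h : ℝ} (hh : h ≠ 0) (u : MeshFun) (η θ : ℤ × ℤ) (x y : ℝ) :
    u.poly h η .lower (cellPoint h θ (x, y)) =
      u η 0 + (u η 1 - u η 0) * (θ.1 + x - η.1) + (u η 2 - u η 0) * (θ.2 + y - η.2) := by
  simp [MeshFun.poly, cellPoint, hh]

lemma poly_upper_cellPoint {h : ℝ} (hh : h ≠ 0) (u : MeshFun) (η θ : ℤ × ℤ) (x y : ℝ) :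
    u.poly h η .upper (cellPoint h θ (x, y)) =
      u η 4 + (u η 3 - u η 4) * (1 - (θ.1 + x - η.1)) +
        (u η 5 - u η 4) * (1 - (θ.2 + y - η.2)) := by
  simp [MeshFun.poly, cellPoint, hh]

lemma hasDerivAt_quadratic (p q r : ℂ) (x : ℝ) :
    HasDerivAt (fun x : ℝ => p + q * x + r * x ^ 2) (q + 2 * r * x) x := by
  have h1 : HasDerivAt (fun x : ℝ => (x : ℂ)) 1 x := Complex.ofRealCLM.hasDerivAt
  have h2 := ((h1.const_mul q).const_add p).add ((h1.pow 2).const_mul r)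
  refine h2.congr_deriv ?_
  norm_num
  ring

/-- `RT₁` is invariant under translation and scaling, and the constant part of `p₀` is absorbed by
`P₁²`. This leaves eight coefficients in cell coordinates. By Euler's identity the quadratic part
`(x, y) (d x + e y)` has divergence `3 (d x + e y)`; the factor `h` comes from the chain rule. -/
lemma IsRT1.exists_coeff {f : ℝ × ℝ → ℂ × ℂ} (hf : IsRT1 f) (h : ℝ) (η : ℤ × ℤ) :
    ∃ a₁ b₁ c₁ a₂ b₂ c₂ d e : ℂ,
      (∀ x y : ℝ, f (cellPoint h η (x, y)) =
        (a₁ + b₁ * x + c₁ * y + x * (d * x + e * y),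
          a₂ + b₂ * x + c₂ * y + y * (d * x + e * y))) ∧
      ∀ x y : ℝ, h * divergence f (cellPoint h η (x, y)) = b₁ + c₂ + 3 * (d * x + e * y) := by
  obtain ⟨p₁, p₂, p₀, ⟨α₁, β₁, γ₁, h₁⟩, ⟨α₂, β₂, γ₂, h₂⟩, ⟨α₀, β₀, γ₀, h₀⟩, hf⟩ := hf
  have hdiv (x y : ℝ) : divergence f (x, y) =
      β₁ + γ₂ + 2 * α₀ + 3 * (β₀ * x + γ₀ * y) := by
    have e₁ : (fun x : ℝ => (f (x, y)).1) =
        fun x : ℝ => (α₁ + γ₁ * y) + (β₁ + α₀ + γ₀ * y) * x + β₀ * x ^ 2 := by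
      funext x; simp [hf, h₁, h₀]; ring
    have e₂ : (fun y : ℝ => (f (x, y)).2) =
        fun y : ℝ => (α₂ + β₂ * x) + (γ₂ + α₀ + β₀ * x) * y + γ₀ * y ^ 2 := by
      funext y; simp [hf, h₂, h₀]; ring
    simp only [divergence]
    rw [e₁, e₂, (hasDerivAt_quadratic _ _ _ x).deriv, (hasDerivAt_quadratic _ _ _ y).deriv]
    ring
  refine ⟨α₁ + (β₁ + α₀) * (η.1 * h) + γ₁ * (η.2 * h) + η.1 * h * (β₀ * (η.1 * h) +
      γ₀ * (η.2 * h)),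
    h * (β₁ + α₀ + 2 * β₀ * (η.1 * h) + γ₀ * (η.2 * h)), h * (γ₁ + γ₀ * (η.1 * h)),
    α₂ + β₂ * (η.1 * h) + (γ₂ + α₀) * (η.2 * h) + η.2 * h * (β₀ * (η.1 * h) + γ₀ * (η.2 * h)),
    h * (β₂ + β₀ * (η.2 * h)), h * (γ₂ + α₀ + 2 * γ₀ * (η.2 * h) + β₀ * (η.1 * h)),
    h ^ 2 * β₀, h ^ 2 * γ₀, fun x y => ?_, fun x y => ?_⟩
  · rw [hf, h₁, h₂, h₀]
    simp only [cellPoint, Prod.mk.injEq]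
    push_cast
    constructor <;> ring
  · simp only [cellPoint, hdiv]
    push_cast
    ring

lemma isRT1_of_coeff (h : ℝ) (η : ℤ × ℤ) (a₁ b₁ c₁ a₂ b₂ c₂ d e : ℂ) :
    IsRT1 fun r : ℝ × ℝ =>
      (a₁ + b₁ * (r.1 / h - η.1) + c₁ * (r.2 / h - η.2) +
          (r.1 / h - η.1) * (d * (r.1 / h - η.1) + e * (r.2 / h - η.2)),
        a₂ + b₂ * (r.1 / h - η.1) + c₂ * (r.2 / h - η.2) +
          (r.2 / h - η.2) * (d * (r.1 / h - η.1) + e * (r.2 / h - η.2))) := by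
  refine ⟨fun r => (a₁ - b₁ * η.1 - c₁ * η.2 + η.1 * (d * η.1 + e * η.2)) +
      (b₁ / h - d * η.1 / h) * r.1 + (c₁ / h - e * η.1 / h) * r.2,
    fun r => (a₂ - b₂ * η.1 - c₂ * η.2 + η.2 * (d * η.1 + e * η.2)) +
      (b₂ / h - d * η.2 / h) * r.1 + (c₂ / h - e * η.2 / h) * r.2,
    fun r => (-(d * η.1 + e * η.2) / h) + (d / h / h) * r.1 + (e / h / h) * r.2,
    ⟨_, _, _, fun r => rfl⟩, ⟨_, _, _, fun r => rfl⟩, ⟨_, _, _, fun r => rfl⟩, fun r => ?_⟩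
  simp only [Prod.mk.injEq]
  constructor <;> ring

lemma riemannFlux_lower_horizontal {a b h : ℝ} (hb : 0 ≤ b) (hh : h ≠ 0)
    (u : MeshFun) (η : ℤ × ℤ) (x : ℝ) :
    riemannFlux (a, b) h u η .lower .horizontal (cellPoint h η (x, 0)) =
      -b * (u (η.1, η.2 - 1) 3 + (u (η.1, η.2 - 1) 4 - u (η.1, η.2 - 1) 3) * x) := by
  -- For `b = 0` the definition takes the trace from inside the triangle, but the factor `ω · n`
  -- vanishes.
  rcases hb.eq_or_lt with rfl | hb
  · simp [riemannFlux, outwardNormal]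
  · simp [riemannFlux, outwardNormal, neighborCell, Half.other, poly_upper_cellPoint hh, hb]
    ring_nf
    simp

lemma riemannFlux_lower_vertical {a b h : ℝ} (ha : 0 < a) (hh : h ≠ 0)
    (u : MeshFun) (η : ℤ × ℤ) (y : ℝ) :
    riemannFlux (a, b) h u η .lower .vertical (cellPoint h η (0, y)) =
      -a * (u (η.1 - 1, η.2) 5 + (u (η.1 - 1, η.2) 4 - u (η.1 - 1, η.2) 5) * y) := by
  simp [riemannFlux, outwardNormal, neighborCell, Half.other, poly_upper_cellPoint hh, ha]
  ring_nf
  simp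

lemma riemannFlux_lower_diagonal {a b h : ℝ} (ha : 0 < a) (hb : 0 ≤ b) (hh : h ≠ 0)
    (u : MeshFun) (η : ℤ × ℤ) (s : ℝ) :
    riemannFlux (a, b) h u η .lower .diagonal (cellPoint h η (1 - s, s)) =
      (a + b) / √2 * (u η 1 + (u η 2 - u η 1) * s) := by
  have : ¬ (a * (√2)⁻¹ + b * (√2)⁻¹ < 0) := by push Not; positivity
  simp [riemannFlux, outwardNormal, poly_lower_cellPoint hh, this]
  ring

lemma riemannFlux_upper_horizontal {a b h : ℝ} (hb : 0 ≤ b) (hh : h ≠ 0)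
    (u : MeshFun) (η : ℤ × ℤ) (x : ℝ) :
    riemannFlux (a, b) h u η .upper .horizontal (cellPoint h η (x, 1)) =
      b * (u η 3 + (u η 4 - u η 3) * x) := by
  simp [riemannFlux, outwardNormal, poly_upper_cellPoint hh, hb.not_gt]
  ring_nf
  simp

lemma riemannFlux_upper_vertical {a b h : ℝ} (ha : 0 < a) (hh : h ≠ 0)
    (u : MeshFun) (η : ℤ × ℤ) (y : ℝ) :
    riemannFlux (a, b) h u η .upper .vertical (cellPoint h η (1, y)) =
      a * (u η 5 + (u η 4 - u η 5) * y) := by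
  simp [riemannFlux, outwardNormal, poly_upper_cellPoint hh, ha.not_gt]
  ring_nf
  simp

lemma riemannFlux_upper_diagonal {a b h : ℝ} (ha : 0 < a) (hb : 0 ≤ b) (hh : h ≠ 0)
    (u : MeshFun) (η : ℤ × ℤ) (s : ℝ) :
    riemannFlux (a, b) h u η .upper .diagonal (cellPoint h η (1 - s, s)) =
      -((a + b) / √2) * (u η 1 + (u η 2 - u η 1) * s) := by
  have : -(a * (√2)⁻¹) < b * (√2)⁻¹ := by
    have : 0 < a * (√2)⁻¹ := by positivity
    have : 0 ≤ b * (√2)⁻¹ := by positivity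
    linarith
  simp [riemannFlux, outwardNormal, neighborCell, Half.other, poly_lower_cellPoint hh, this]
  ring

lemma eq_zero_of_affine_eq_zero {p q : ℂ} {s₀ s₁ : ℝ} (hs : s₀ ≠ s₁) (h₀ : p + q * s₀ = 0)
    (h₁ : p + q * s₁ = 0) : p = 0 ∧ q = 0 := by
  have hs' : (s₀ : ℂ) - s₁ ≠ 0 := sub_ne_zero.2 (by exact_mod_cast hs)
  have hq : q = 0 := by
    have : q * ((s₀ : ℂ) - s₁) = 0 := by linear_combination h₀ - h₁
    exact (mul_eq_zero.1 this).resolve_right hs'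
  exact ⟨by simpa [hq] using h₀, hq⟩

lemma MeshFun.poly_lower_of_coord {h : ℝ} (hh : h ≠ 0) {u : MeshFun} {η : ℤ × ℤ} {p q r : ℂ}
    {g : ℝ × ℝ → ℂ} (hg : ∀ x y : ℝ, h * g (cellPoint h η (x, y)) = p + q * x + r * y)
    (h₀ : h * u η 0 = p) (h₁ : h * u η 1 = p + q) (h₂ : h * u η 2 = p + r) :
    ∀ x : ℝ × ℝ, g x = u.poly h η .lower x := by
  intro x
  have hx : x = cellPoint h η (x.1 / h - η.1, x.2 / h - η.2) := by
    ext <;> simp [cellPoint, hh]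
  have hh' : (h : ℂ) ≠ 0 := by exact_mod_cast hh
  rw [hx]
  apply mul_left_cancel₀ hh'
  rw [hg, poly_lower_cellPoint hh]
  linear_combination (-1 + (x.1 / h - η.1 : ℝ) + (x.2 / h - η.2 : ℝ) : ℂ) * h₀
    - (x.1 / h - η.1 : ℝ) * h₁ - (x.2 / h - η.2 : ℝ) * h₂

lemma MeshFun.poly_upper_of_coord {h : ℝ} (hh : h ≠ 0) {u : MeshFun} {η : ℤ × ℤ} {p q r : ℂ}
    {g : ℝ × ℝ → ℂ} (hg : ∀ x y : ℝ, h * g (cellPoint h η (x, y)) = p + q * x + r * y)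
    (h₃ : h * u η 3 = p + r) (h₄ : h * u η 4 = p + q + r) (h₅ : h * u η 5 = p + q) :
    ∀ x : ℝ × ℝ, g x = u.poly h η .upper x := by
  intro x
  have hx : x = cellPoint h η (x.1 / h - η.1, x.2 / h - η.2) := by
    ext <;> simp [cellPoint, hh]
  have hh' : (h : ℂ) ≠ 0 := by exact_mod_cast hh
  rw [hx]
  apply mul_left_cancel₀ hh'
  rw [hg, poly_upper_cellPoint hh]
  linear_combination (1 - (x.1 / h - η.1 : ℝ) - (x.2 / h - η.2 : ℝ) : ℂ) * h₄
    - (1 - (x.1 / h - η.1 : ℝ)) * h₃ - (1 - (x.2 / h - η.2 : ℝ)) * h₅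

section

variable {a b h : ℝ} {s : EdgeFamily → Fin 2 → ℝ} {u : MeshFun} {η : ℤ × ℤ}
  {f : ℝ × ℝ → ℂ × ℂ}

lemma IsFlux.neg_divergence_lower (ha : 0 < a) (hb : 0 ≤ b) (hh : h ≠ 0)
    (hs : ∀ E, s E 0 ≠ s E 1) (hf : IsFlux (a, b) s h u η .lower f) (r : ℝ × ℝ) :
    -divergence f r = (meshRate a b h u).poly h η .lower r := by
  obtain ⟨a₁, b₁, c₁, a₂, b₂, c₂, d, e, hc, hdiv⟩ := hf.mem_RT1.exists_coeff h η
  have hh' : (h : ℂ) ≠ 0 := by exact_mod_cast hh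
  have h2 : ((√2 : ℝ) : ℂ) ≠ 0 := by simp
  have hint := hf.interior
  have E₁ (i : Fin 2) := hf.edge .horizontal i
  have E₂ (i : Fin 2) := hf.edge .vertical i
  have E₃ (i : Fin 2) := hf.edge .diagonal i
  simp only [edgePoint, riemannFlux_lower_horizontal hb hh, outwardNormal, hc,
    riemannFlux_lower_vertical ha hh, riemannFlux_lower_diagonal ha hb hh] at E₁ E₂ E₃
  simp only [massCenter, hc, poly_lower_cellPoint hh, Prod.mk.injEq] at hint
  -- Each edge condition is affine in the edge parameter, so its two collocation points give two
  -- coefficient identities. This is the only use of the points.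
  obtain ⟨h₁, h₁'⟩ := eq_zero_of_affine_eq_zero (hs .horizontal)
    (p := a₂ - b * u (η.1, η.2 - 1) 3)
    (q := b₂ - b * (u (η.1, η.2 - 1) 4 - u (η.1, η.2 - 1) 3))
    (by have := E₁ 0; push_cast at this; linear_combination -this)
    (by have := E₁ 1; push_cast at this; linear_combination -this)
  obtain ⟨h₂, h₂'⟩ := eq_zero_of_affine_eq_zero (hs .vertical)
    (p := a₁ - a * u (η.1 - 1, η.2) 5)
    (q := c₁ - a * (u (η.1 - 1, η.2) 4 - u (η.1 - 1, η.2) 5))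
    (by have := E₂ 0; push_cast at this; linear_combination -this)
    (by have := E₂ 1; push_cast at this; linear_combination -this)
  -- On `x + y = 1` the two quadratic parts add up to `(x + y) (d x + e y) = d x + e y`, so the
  -- normal trace is affine here too.
  obtain ⟨h₃, h₃'⟩ := eq_zero_of_affine_eq_zero (hs .diagonal)
    (p := a₁ + a₂ + b₁ + b₂ + d - (a + b) * u η 1)
    (q := c₁ + c₂ - b₁ - b₂ + e - d - (a + b) * (u η 2 - u η 1))
    (by have := E₃ 0; push_cast at this; field_simp at this; linear_combination this)
    (by have := E₃ 1; push_cast at this; field_simp at this; linear_combination this)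
  obtain ⟨h₄, h₅⟩ := hint
  push_cast at h₄ h₅
  refine MeshFun.poly_lower_of_coord hh (g := fun r => -divergence f r)
    (p := -(b₁ + c₂)) (q := -3 * d) (r := -3 * e) (fun x y => ?_) ?_ ?_ ?_ r
  · linear_combination -hdiv x y
  all_goals
    simp only [meshRate, cellRate, mul_inv_cancel_left₀ hh']
    simp
    grind

lemma IsFlux.neg_divergence_upper (ha : 0 < a) (hb : 0 ≤ b) (hh : h ≠ 0)
    (hs : ∀ E, s E 0 ≠ s E 1) (hf : IsFlux (a, b) s h u η .upper f) (r : ℝ × ℝ) :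
    -divergence f r = (meshRate a b h u).poly h η .upper r := by
  obtain ⟨a₁, b₁, c₁, a₂, b₂, c₂, d, e, hc, hdiv⟩ := hf.mem_RT1.exists_coeff h η
  have hh' : (h : ℂ) ≠ 0 := by exact_mod_cast hh
  have h2 : ((√2 : ℝ) : ℂ) ≠ 0 := by simp
  have hint := hf.interior
  have E₁ (i : Fin 2) := hf.edge .horizontal i
  have E₂ (i : Fin 2) := hf.edge .vertical i
  have E₃ (i : Fin 2) := hf.edge .diagonal i
  simp only [edgePoint, riemannFlux_upper_horizontal hb hh, outwardNormal, hc,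
    riemannFlux_upper_vertical ha hh, riemannFlux_upper_diagonal ha hb hh] at E₁ E₂ E₃
  simp only [massCenter, hc, poly_upper_cellPoint hh, Prod.mk.injEq] at hint
  obtain ⟨h₁, h₁'⟩ := eq_zero_of_affine_eq_zero (hs .horizontal)
    (p := a₂ + c₂ + e - b * u η 3) (q := b₂ + d - b * (u η 4 - u η 3))
    (by have := E₁ 0; push_cast at this; linear_combination this)
    (by have := E₁ 1; push_cast at this; linear_combination this)
  obtain ⟨h₂, h₂'⟩ := eq_zero_of_affine_eq_zero (hs .vertical)
    (p := a₁ + b₁ + d - a * u η 5) (q := c₁ + e - a * (u η 4 - u η 5))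
    (by have := E₂ 0; push_cast at this; linear_combination this)
    (by have := E₂ 1; push_cast at this; linear_combination this)
  obtain ⟨h₃, h₃'⟩ := eq_zero_of_affine_eq_zero (hs .diagonal)
    (p := a₁ + a₂ + b₁ + b₂ + d - (a + b) * u η 1)
    (q := c₁ + c₂ - b₁ - b₂ + e - d - (a + b) * (u η 2 - u η 1))
    (by have := E₃ 0; push_cast at this; field_simp at this; linear_combination -this)
    (by have := E₃ 1; push_cast at this; field_simp at this; linear_combination -this)
  obtain ⟨h₄, h₅⟩ := hint
  push_cast at h₄ h₅
  refine MeshFun.poly_upper_of_coord hh (g := fun r => -divergence f r)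
    (p := -(b₁ + c₂)) (q := -3 * d) (r := -3 * e) (fun x y => ?_) ?_ ?_ ?_ r
  · linear_combination -hdiv x y
  all_goals
    simp only [meshRate, cellRate, mul_inv_cancel_left₀ hh']
    simp
    grind

end

lemma exists_isRT1_coeff {h : ℝ} (hh : h ≠ 0) (η : ℤ × ℤ) (a₁ b₁ c₁ a₂ b₂ c₂ d e : ℂ) :
    ∃ f, IsRT1 f ∧ ∀ x y : ℝ, f (cellPoint h η (x, y)) =
        (a₁ + b₁ * x + c₁ * y + x * (d * x + e * y),
          a₂ + b₂ * x + c₂ * y + y * (d * x + e * y)) := by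
  refine ⟨_, isRT1_of_coeff h η a₁ b₁ c₁ a₂ b₂ c₂ d e, fun x y => ?_⟩
  simp [cellPoint, hh]

/-- The flux is `ω u_e`, which lies in `RT₁`, plus a lifting of the inflow jumps: a field that
vanishes at the mass center, has zero normal trace on the outflow (diagonal) edge and the jumps `α₀,
α₁`, `β₀, β₁` on the vertical and the horizontal edge. -/
lemma exists_isFlux_lower {a b h : ℝ} (ha : 0 < a) (hb : 0 ≤ b) (hh : h ≠ 0)
    (s : EdgeFamily → Fin 2 → ℝ) (u : MeshFun) (η : ℤ × ℤ) :
    ∃ f, IsFlux (a, b) s h u η .lower f := by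
  have h2 : ((√2 : ℝ) : ℂ) ≠ 0 := by simp
  set α₀ := a * (u (η.1 - 1, η.2) 5 - u η 0) with hα₀
  set α₁ := a * (u (η.1 - 1, η.2) 4 - u η 2) with hα₁
  set β₀ := b * (u (η.1, η.2 - 1) 3 - u η 0) with hβ₀
  set β₁ := b * (u (η.1, η.2 - 1) 4 - u η 1) with hβ₁
  obtain ⟨f, hf, hc⟩ := exists_isRT1_coeff hh η (a * u (η.1 - 1, η.2) 5)
    (a * (u η 1 - u η 0) - 3 * α₀ - α₁ - β₀)
    (a * (u (η.1 - 1, η.2) 4 - u (η.1 - 1, η.2) 5)) (b * u (η.1, η.2 - 1) 3)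
    (b * (u (η.1, η.2 - 1) 4 - u (η.1, η.2 - 1) 3))
    (b * (u η 2 - u η 0) - 3 * β₀ - β₁ - α₀)
    (2 * α₀ + α₁ + β₀ - β₁) (2 * β₀ + β₁ + α₀ - α₁)
  refine ⟨f, hf, ?_, ?_⟩
  · simp only [massCenter, hc, poly_lower_cellPoint hh, Prod.mk.injEq]
    push_cast
    constructor <;> grind
  · rintro (_ | _ | _) i <;>
    simp only [edgePoint, riemannFlux_lower_horizontal hb hh, outwardNormal, hc,
      riemannFlux_lower_vertical ha hh, riemannFlux_lower_diagonal ha hb hh] <;>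
    push_cast
    · ring
    · ring
    · field_simp
      grind

/-- As for the lower triangle, except that the diagonal is now the only inflow edge, with the jumps
`γ₁`, `γ₂` at its ends. -/
lemma exists_isFlux_upper {a b h : ℝ} (ha : 0 < a) (hb : 0 ≤ b) (hh : h ≠ 0)
    (s : EdgeFamily → Fin 2 → ℝ) (u : MeshFun) (η : ℤ × ℤ) :
    ∃ f, IsFlux (a, b) s h u η .upper f := by
  have h2 : ((√2 : ℝ) : ℂ) ≠ 0 := by simp
  set γ₁ := -(a + b) * (u η 2 - u η 3) with hγ₁
  set γ₂ := -(a + b) * (u η 1 - u η 5) with hγ₂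
  obtain ⟨f, hf, hc⟩ := exists_isRT1_coeff hh η
    (a * (u η 3 + u η 5 - u η 4) - 2 * (γ₁ + γ₂))
    (a * (u η 4 - u η 3) + 4 * γ₁ + 3 * γ₂) (a * (u η 4 - u η 5) + γ₁ + 2 * γ₂)
    (b * (u η 3 + u η 5 - u η 4) - 2 * (γ₁ + γ₂))
    (b * (u η 4 - u η 3) + 2 * γ₁ + γ₂) (b * (u η 4 - u η 5) + 3 * γ₁ + 4 * γ₂)
    (-(2 * γ₁ + γ₂)) (-(γ₁ + 2 * γ₂))
  refine ⟨f, hf, ?_, ?_⟩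
  · simp only [massCenter, hc, poly_upper_cellPoint hh, Prod.mk.injEq]
    push_cast
    constructor <;> ring
  · rintro (_ | _ | _) i <;>
    simp only [edgePoint, riemannFlux_upper_horizontal hb hh, outwardNormal, hc,
      riemannFlux_upper_vertical ha hh, riemannFlux_upper_diagonal ha hb hh] <;>
    push_cast
    · ring
    · ring
    · field_simp
      grind

lemma MeshFun.poly_lower_vertices {h : ℝ} (hh : h ≠ 0) (u : MeshFun) (η : ℤ × ℤ) :
    u.poly h η .lower (cellPoint h η (0, 0)) = u η 0 ∧
      u.poly h η .lower (cellPoint h η (1, 0)) = u η 1 ∧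
      u.poly h η .lower (cellPoint h η (0, 1)) = u η 2 := by
  simp [poly_lower_cellPoint hh]

lemma MeshFun.poly_upper_vertices {h : ℝ} (hh : h ≠ 0) (u : MeshFun) (η : ℤ × ℤ) :
    u.poly h η .upper (cellPoint h η (0, 1)) = u η 3 ∧
      u.poly h η .upper (cellPoint h η (1, 1)) = u η 4 ∧
      u.poly h η .upper (cellPoint h η (1, 0)) = u η 5 := by
  simp [poly_upper_cellPoint hh]

lemma hasDerivWithinAt_poly_iff {h : ℝ} (hh : h ≠ 0) {u : ℝ → MeshFun} {w : MeshFun}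
    {η : ℤ × ℤ} {S : Set ℝ} {t : ℝ} :
    (∀ T r, HasDerivWithinAt (fun τ => (u τ).poly h η T r) (w.poly h η T r) S t) ↔
      ∀ ξ, HasDerivWithinAt (fun τ => u τ η ξ) (w η ξ) S t := by
  constructor
  · intro H ξ
    have h₀ := H .lower (cellPoint h η (0, 0))
    have h₁ := H .lower (cellPoint h η (1, 0))
    have h₂ := H .lower (cellPoint h η (0, 1))
    have h₃ := H .upper (cellPoint h η (0, 1))
    have h₄ := H .upper (cellPoint h η (1, 1))
    have h₅ := H .upper (cellPoint h η (1, 0))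
    simp only [MeshFun.poly_lower_vertices hh] at h₀ h₁ h₂
    simp only [MeshFun.poly_upper_vertices hh] at h₃ h₄ h₅
    fin_cases ξ <;> assumption
  · rintro H (_ | _) r
    · exact ((H 0).add (((H 1).sub (H 0)).mul_const _)).add (((H 2).sub (H 0)).mul_const _)
    · exact ((H 4).add (((H 3).sub (H 4)).mul_const _)).add (((H 5).sub (H 4)).mul_const _)

/-- The scheme is a linear system of ordinary differential equations for the vertex values. -/
lemma isSolution_iff {a b : ℝ} (ha : 0 < a) (hb : 0 ≤ b) {s : EdgeFamily → Fin 2 → ℝ}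
    (hs : ∀ E, s E 0 ≠ s E 1) {N : ℕ} (hN : 0 < N) {u : ℝ → MeshFun} :
    IsSolution (a, b) s N u ↔ ∀ t : ℝ, 0 ≤ t → (u t).IsPeriodic N ∧
      ∀ η ξ, HasDerivWithinAt (fun τ => u τ η ξ) (meshRate a b (1 / N) (u t) η ξ) (Ici 0) t := by
  have hh : (1 / N : ℝ) ≠ 0 := by positivity
  refine forall₂_congr fun t _ => and_congr_right fun _ => forall_congr' fun η => ?_
  rw [← hasDerivWithinAt_poly_iff hh]
  refine forall_congr' fun T => ⟨?_, fun H => ?_⟩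
  · rintro ⟨f, hf, H⟩ r
    refine (H r).congr_deriv ?_
    cases T
    · exact hf.neg_divergence_lower ha hb hh hs r
    · exact hf.neg_divergence_upper ha hb hh hs r
  · cases T
    · obtain ⟨f, hf⟩ := exists_isFlux_lower ha hb hh s (u t) η
      exact ⟨f, hf, fun r => (H r).congr_deriv (hf.neg_divergence_lower ha hb hh hs r).symm⟩
    · obtain ⟨f, hf⟩ := exists_isFlux_upper ha hb hh s (u t) η
      exact ⟨f, hf, fun r => (H r).congr_deriv (hf.neg_divergence_upper ha hb hh hs r).symm⟩

/-! ### Stability -/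

/-- The inner product in which the scheme is dissipative. On each triangle it is the `L²` inner
product of the mean values plus `4 / 3` of the `L²` inner product of the fluctuations, up to a
common factor. -/
def energyForm (w z : Fin 6 → ℝ) : ℝ :=
  3 * (w 0 * z 0 + w 1 * z 1 + w 2 * z 2 + w 3 * z 3 + w 4 * z 4 + w 5 * z 5)
    + 2 * ((w 0 + w 1 + w 2) * (z 0 + z 1 + z 2) + (w 3 + w 4 + w 5) * (z 3 + z 4 + z 5))

lemma energyForm_self_nonneg (w : Fin 6 → ℝ) : 0 ≤ energyForm w w := by
  simp only [energyForm, ← pow_two]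
  positivity

lemma three_mul_sum_sq_le_energyForm (w : Fin 6 → ℝ) :
    3 * ∑ ξ, w ξ ^ 2 ≤ energyForm w w := by
  simp only [energyForm, ← pow_two, Fin.sum_univ_six]
  have h₁ := sq_nonneg (w 0 + w 1 + w 2)
  have h₂ := sq_nonneg (w 3 + w 4 + w 5)
  linarith

lemma energyForm_self_le {w : Fin 6 → ℝ} {δ : ℝ} (hw : ∀ ξ, |w ξ| ≤ δ) :
    energyForm w w ≤ 54 * δ ^ 2 := by
  have h (ξ : Fin 6) : w ξ ^ 2 ≤ δ ^ 2 := sq_le_sq' (abs_le.1 (hw ξ)).1 (abs_le.1 (hw ξ)).2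
  simp only [energyForm]
  nlinarith [h 0, h 1, h 2, h 3, h 4, h 5, sq_nonneg (w 0 - w 1), sq_nonneg (w 0 - w 2),
    sq_nonneg (w 1 - w 2), sq_nonneg (w 3 - w 4), sq_nonneg (w 3 - w 5), sq_nonneg (w 4 - w 5)]

/-- Nonnegativity of the energy of `p w + q z`; a Cauchy–Schwarz inequality that can be summed over
cells with fixed weights. -/
lemma neg_energyForm_le (w z : Fin 6 → ℝ) (p q : ℝ) :
    -(2 * p * q * energyForm w z) ≤ p ^ 2 * energyForm w w + q ^ 2 * energyForm z z := by
  have h := energyForm_self_nonneg fun ξ => p * w ξ + q * z ξ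
  simp only [energyForm] at h ⊢
  linarith

/-- Three times the integral of the square of the linear function with the end values `x`, `y`. -/
def edgeForm (x y : ℝ) : ℝ := x ^ 2 + x * y + y ^ 2

lemma edgeForm_nonneg (x y : ℝ) : 0 ≤ edgeForm x y := by
  unfold edgeForm
  nlinarith [sq_nonneg (x + y), sq_nonneg x, sq_nonneg y]

/-- The weights of `energyForm` are such that all volume and cross terms combine into an exact
identity (`key`): inflow minus outflow of `edgeForm` through the vertical and horizontal edges,
minus the `edgeForm` of the jumps on all three edges. -/
lemma energyForm_cellRate_le {a b : ℝ} (ha : 0 ≤ a) (hb : 0 ≤ b) (u l d : Fin 6 → ℝ) :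
    2 * energyForm u (cellRate a b u l d) ≤
      18 * a * (edgeForm (l 5) (l 4) - edgeForm (u 5) (u 4)) +
        18 * b * (edgeForm (d 3) (d 4) - edgeForm (u 3) (u 4)) := by
  have h₁ := mul_nonneg ha (edgeForm_nonneg (l 5 - u 0) (l 4 - u 2))
  have h₂ := mul_nonneg hb (edgeForm_nonneg (d 3 - u 0) (d 4 - u 1))
  have h₃ := mul_nonneg (add_nonneg ha hb) (edgeForm_nonneg (u 1 - u 5) (u 2 - u 3))
  have key : 2 * energyForm u (cellRate a b u l d) =
      18 * a * (edgeForm (l 5) (l 4) - edgeForm (u 5) (u 4)) +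
        18 * b * (edgeForm (d 3) (d 4) - edgeForm (u 3) (u 4))
      - 18 * (a * edgeForm (l 5 - u 0) (l 4 - u 2) + b * edgeForm (d 3 - u 0) (d 4 - u 1)
        + (a + b) * edgeForm (u 1 - u 5) (u 2 - u 3)) := by
    simp only [energyForm, cellRate, edgeForm]
    simp
    ring
  linarith

lemma sum_Icc_sub_one_sub (f : ℤ → ℝ) (N : ℕ) :
    ∑ i ∈ Finset.Icc (1 : ℤ) N, (f (i - 1) - f i) = f 0 - f N := by
  induction N with
  | zero => simp
  | succ n ih =>
    have : Finset.Icc (1 : ℤ) (n + 1 : ℕ) = insert (n + 1 : ℤ) (Finset.Icc (1 : ℤ) n) := by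
      ext; simp; omega
    rw [this, Finset.sum_insert (by simp), ih]
    push_cast
    ring_nf

/-- The discrete energy of real vertex values over the periodic cell. -/
def totalEnergy (N : ℕ) (e : ℤ × ℤ → Fin 6 → ℝ) : ℝ :=
  ∑ i ∈ Finset.Icc (1 : ℤ) N, ∑ j ∈ Finset.Icc (1 : ℤ) N, energyForm (e (i, j)) (e (i, j))

lemma totalEnergy_nonneg (N : ℕ) (e : ℤ × ℤ → Fin 6 → ℝ) : 0 ≤ totalEnergy N e :=
  Finset.sum_nonneg fun _ _ => Finset.sum_nonneg fun _ _ => energyForm_self_nonneg _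

lemma totalEnergy_le {N : ℕ} {e : ℤ × ℤ → Fin 6 → ℝ} {δ : ℝ} (he : ∀ η ξ, |e η ξ| ≤ δ) :
    totalEnergy N e ≤ 54 * (N * δ) ^ 2 := by
  calc totalEnergy N e ≤ ∑ i ∈ Finset.Icc (1 : ℤ) N, ∑ j ∈ Finset.Icc (1 : ℤ) N, 54 * δ ^ 2 :=
        Finset.sum_le_sum fun _ _ => Finset.sum_le_sum fun _ _ => energyForm_self_le (he _)
    _ = 54 * (N * δ) ^ 2 := by simp; ring

lemma sum_energyForm_cellRate_nonpos {a b : ℝ} (ha : 0 ≤ a) (hb : 0 ≤ b) {N : ℕ}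
    {e : ℤ × ℤ → Fin 6 → ℝ} (he : ∀ η : ℤ × ℤ, e (η.1 + N, η.2) = e η ∧ e (η.1, η.2 + N) = e η) :
    ∑ i ∈ Finset.Icc (1 : ℤ) N, ∑ j ∈ Finset.Icc (1 : ℤ) N,
      2 * energyForm (e (i, j)) (cellRate a b (e (i, j)) (e (i - 1, j)) (e (i, j - 1))) ≤ 0 := by
  refine (Finset.sum_le_sum fun _ _ => Finset.sum_le_sum fun _ _ =>
    energyForm_cellRate_le ha hb _ _ _).trans (le_of_eq ?_)
  simp only [Finset.sum_add_distrib, ← Finset.mul_sum]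
  have h₁ : ∑ i ∈ Finset.Icc (1 : ℤ) N, ∑ j ∈ Finset.Icc (1 : ℤ) N,
      (edgeForm (e (i - 1, j) 5) (e (i - 1, j) 4) - edgeForm (e (i, j) 5) (e (i, j) 4)) = 0 := by
    rw [Finset.sum_comm]
    refine Finset.sum_eq_zero fun j _ => ?_
    rw [sum_Icc_sub_one_sub fun i => edgeForm (e (i, j) 5) (e (i, j) 4)]
    have := (he (0, j)).1
    simp only [zero_add] at this
    rw [this, sub_self]
  have h₂ : ∑ i ∈ Finset.Icc (1 : ℤ) N, ∑ j ∈ Finset.Icc (1 : ℤ) N,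
      (edgeForm (e (i, j - 1) 3) (e (i, j - 1) 4) - edgeForm (e (i, j) 3) (e (i, j) 4)) = 0 := by
    refine Finset.sum_eq_zero fun i _ => ?_
    rw [sum_Icc_sub_one_sub fun j => edgeForm (e (i, j) 3) (e (i, j) 4)]
    have := (he (i, 0)).2
    simp only [zero_add] at this
    rw [this, sub_self]
  rw [h₁, h₂]
  ring

lemma hasDerivWithinAt_energyForm {e : ℝ → Fin 6 → ℝ} {e' : Fin 6 → ℝ} {S : Set ℝ} {t : ℝ}
    (h : ∀ ξ, HasDerivWithinAt (fun τ => e τ ξ) (e' ξ) S t) :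
    HasDerivWithinAt (fun τ => energyForm (e τ) (e τ)) (2 * energyForm (e t) e') S t := by
  have hm (i j : Fin 6) := (h i).mul (h j)
  have hp := (((h 0).add (h 1)).add (h 2))
  have hq := (((h 3).add (h 4)).add (h 5))
  refine ((((((((hm 0 0).add (hm 1 1)).add (hm 2 2)).add (hm 3 3)).add (hm 4 4)).add
    (hm 5 5)).const_mul 3).add (((hp.mul hp).add (hq.mul hq)).const_mul 2)).congr_deriv ?_
  simp only [energyForm, Pi.add_apply]
  ring

/-- The rate of the scheme does not increase the energy, since the edge terms telescope over the
period. Formally the derivative of `√y` is then at most the energy norm of the source, which is at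
most `√54 N δ ≤ 8 N δ`. -/
theorem sqrt_totalEnergy_le {a b : ℝ} (ha : 0 ≤ a) (hb : 0 ≤ b) {N : ℕ} (hN : 0 < N)
    {e ρ : ℝ → ℤ × ℤ → Fin 6 → ℝ} {δ : ℝ} (hδ : 0 < δ)
    (hper : ∀ t, 0 ≤ t → ∀ η : ℤ × ℤ, e t (η.1 + N, η.2) = e t η ∧ e t (η.1, η.2 + N) = e t η)
    (hder : ∀ t, 0 ≤ t → ∀ η : ℤ × ℤ, ∀ ξ, HasDerivWithinAt (fun τ => e τ η ξ)
      (N * cellRate a b (e t η) (e t (η.1 - 1, η.2)) (e t (η.1, η.2 - 1)) ξ + ρ t η ξ) (Ici 0) t)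
    (hρ : ∀ t, 0 ≤ t → ∀ η ξ, |ρ t η ξ| ≤ δ) {t : ℝ} (ht : 0 ≤ t) :
    √(totalEnergy N (e t)) ≤ √(totalEnergy N (e 0)) + 8 * N * δ * t := by
  set Δ : ℝ := 8 * N * δ with hΔdef
  have hΔ : 0 < Δ := by positivity
  set y : ℝ → ℝ := fun t => totalEnergy N (e t) with hy
  have hy0 (t : ℝ) : 0 ≤ y t := totalEnergy_nonneg _ _
  -- The number `z` stands for an upper bound of `√y`; it is left free so that nothing is divided by
  -- a possibly vanishing energy.
  have hyd (t : ℝ) (ht : 0 ≤ t) : ∃ y', HasDerivWithinAt y y' (Ici 0) t ∧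
      ∀ z, 0 < z → y t ≤ z ^ 2 → y' ≤ 2 * z * Δ := by
    refine ⟨_, HasDerivWithinAt.fun_sum fun i _ => HasDerivWithinAt.fun_sum fun j _ =>
      hasDerivWithinAt_energyForm (hder t ht (i, j)), fun z hz hyz => ?_⟩
    have hsplit (i j : ℤ) : 2 * energyForm (e t (i, j)) (fun ξ =>
        N * cellRate a b (e t (i, j)) (e t (i - 1, j)) (e t (i, j - 1)) ξ + ρ t (i, j) ξ) =
        N * (2 * energyForm (e t (i, j))
          (cellRate a b (e t (i, j)) (e t (i - 1, j)) (e t (i, j - 1)))) +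
        2 * energyForm (e t (i, j)) (ρ t (i, j)) := by
      simp only [energyForm]; ring
    have hE := sum_energyForm_cellRate_nonpos ha hb (hper t ht)
    have hR : totalEnergy N (ρ t) ≤ Δ ^ 2 := by
      refine (totalEnergy_le (hρ t ht)).trans ?_
      rw [hΔdef]
      nlinarith [sq_nonneg (N * δ)]
    have hb' : 2 * Δ * z * ∑ i ∈ Finset.Icc (1 : ℤ) N, ∑ j ∈ Finset.Icc (1 : ℤ) N,
        energyForm (e t (i, j)) (ρ t (i, j)) ≤ Δ ^ 2 * y t + z ^ 2 * totalEnergy N (ρ t) := by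
      simp only [hy, totalEnergy, Finset.mul_sum, ← Finset.sum_add_distrib]
      refine Finset.sum_le_sum fun i _ => Finset.sum_le_sum fun j _ => ?_
      -- The sign of `-Δ` turns the lower bound for the mixed term into an upper bound.
      have := neg_energyForm_le (e t (i, j)) (ρ t (i, j)) (-Δ) z
      linarith
    simp only [hsplit, Finset.sum_add_distrib, ← Finset.mul_sum]
    simp only [← Finset.mul_sum] at hE
    set S := ∑ i ∈ Finset.Icc (1 : ℤ) N, ∑ j ∈ Finset.Icc (1 : ℤ) N,
      energyForm (e t (i, j)) (ρ t (i, j))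
    have h1 : 2 * Δ * z * S ≤ 2 * Δ * z * (z * Δ) := by
      have h2 : Δ ^ 2 * y t ≤ Δ ^ 2 * z ^ 2 := by gcongr
      have h3 : z ^ 2 * totalEnergy N (ρ t) ≤ z ^ 2 * Δ ^ 2 := by gcongr
      linarith
    have h2 : S ≤ z * Δ := le_of_mul_le_mul_left h1 (by positivity)
    have h3 := mul_nonpos_of_nonneg_of_nonpos (Nat.cast_nonneg (α := ℝ) N) hE
    linarith
  -- The shift by `ε²` makes the square root differentiable where the energy vanishes.
  refine le_of_forall_pos_le_add fun ε hε => ?_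
  have hpos (t : ℝ) : 0 < y t + ε ^ 2 := by have := hy0 t; positivity
  have hanti : AntitoneOn (fun t => √(y t + ε ^ 2) - Δ * t) (Ici 0) := by
    have hcont : ContinuousOn y (Ici 0) := fun t ht =>
      let ⟨_, h, _⟩ := hyd t ht
      h.continuousWithinAt
    refine antitoneOn_of_hasDerivWithinAt_nonpos (f' := fun t =>
      derivWithin (fun t => √(y t + ε ^ 2) - Δ * t) (Ici 0) t) (convex_Ici 0)
      (by fun_prop) (fun t ht => ?_) (fun t ht => ?_)
    all_goals
      rw [interior_Ici] at ht
      obtain ⟨y', h, hle⟩ := hyd t ht.le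
      have hd : HasDerivWithinAt (fun t => √(y t + ε ^ 2) - Δ * t) _ (Ici 0) t :=
        ((h.add_const (ε ^ 2)).sqrt (hpos t).ne').sub
        ((hasDerivWithinAt_id t (Ici 0)).const_mul Δ)
    · rw [interior_Ici]
      exact (hd.differentiableWithinAt.hasDerivWithinAt).mono Ioi_subset_Ici_self
    · have hz : 0 < √(y t + ε ^ 2) := Real.sqrt_pos.2 (hpos t)
      have := hle _ hz (by rw [Real.sq_sqrt (hpos t).le]; nlinarith)
      rw [HasDerivWithinAt.derivWithin hd ((uniqueDiffOn_Ici 0) t (mem_Ici.2 (le_of_lt ht))), mul_one, sub_nonpos,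
        div_le_iff₀ (by positivity)]
      linarith
  have h := hanti self_mem_Ici ht ht
  simp only [mul_zero, sub_zero] at h
  have h₁ : √(y t) ≤ √(y t + ε ^ 2) := Real.sqrt_le_sqrt (by nlinarith)
  have h₂ : √(y 0 + ε ^ 2) ≤ √(y 0) + ε := by
    rw [Real.sqrt_le_left (by positivity)]
    nlinarith [Real.sq_sqrt (hy0 0), Real.sqrt_nonneg (y 0)]
  linarith

lemma cellRate_add {K : Type*} [CommRing K] (a b : K) (u l d u' l' d' : Fin 6 → K) :
    cellRate a b (u + u') (l + l') (d + d') = cellRate a b u l d + cellRate a b u' l' d' := by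
  funext ξ
  fin_cases ξ <;> simp [cellRate] <;> ring

lemma cellRate_smul {K : Type*} [CommRing K] (a b c : K) (u l d : Fin 6 → K) :
    cellRate a b (c • u) (c • l) (c • d) = c • cellRate a b u l d := by
  funext ξ
  fin_cases ξ <;> simp [cellRate] <;> ring

lemma re_cellRate (a b : ℝ) (u l d : Fin 6 → ℂ) (ξ : Fin 6) :
    (cellRate (a : ℂ) b u l d ξ).re =
      cellRate a b (fun i => (u i).re) (fun i => (l i).re) (fun i => (d i).re) ξ := by
  fin_cases ξ <;> simp [cellRate]

lemma im_cellRate (a b : ℝ) (u l d : Fin 6 → ℂ) (ξ : Fin 6) :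
    (cellRate (a : ℂ) b u l d ξ).im =
      cellRate a b (fun i => (u i).im) (fun i => (l i).im) (fun i => (d i).im) ξ := by
  fin_cases ξ <;> simp [cellRate]

lemma re_meshRate (a b : ℝ) (N : ℕ) (u : MeshFun) (η : ℤ × ℤ) (ξ : Fin 6) :
    (meshRate a b (1 / N) u η ξ).re = N * cellRate a b (fun i => (u η i).re)
      (fun i => (u (η.1 - 1, η.2) i).re) (fun i => (u (η.1, η.2 - 1) i).re) ξ := by
  rw [← re_cellRate, meshRate, ← Complex.ofReal_inv, Complex.re_ofReal_mul]
  simp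

lemma im_meshRate (a b : ℝ) (N : ℕ) (u : MeshFun) (η : ℤ × ℤ) (ξ : Fin 6) :
    (meshRate a b (1 / N) u η ξ).im = N * cellRate a b (fun i => (u η i).im)
      (fun i => (u (η.1 - 1, η.2) i).im) (fun i => (u (η.1, η.2 - 1) i).im) ξ := by
  rw [← im_cellRate, meshRate, ← Complex.ofReal_inv, Complex.im_ofReal_mul]
  simp

lemma meshNorm_sq (N : ℕ) (u : MeshFun) : MeshFun.meshNorm N u ^ 2 =
    (1 / (N : ℝ)) ^ 2 * ∑ i ∈ Finset.Icc (1 : ℤ) N, ∑ j ∈ Finset.Icc (1 : ℤ) N,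
      ∑ ξ : Fin 6, ‖u (i, j) ξ‖ ^ 2 := by
  rw [MeshFun.meshNorm, Real.sq_sqrt]
  · simp only [Finset.mul_sum]
  · exact Finset.sum_nonneg fun _ _ => Finset.sum_nonneg fun _ _ => by positivity

lemma meshNorm_nonneg (N : ℕ) (u : MeshFun) : 0 ≤ MeshFun.meshNorm N u := Real.sqrt_nonneg _

lemma meshNorm_add_le (N : ℕ) (u w : MeshFun) :
    MeshFun.meshNorm N (u + w) ≤ 2 * (MeshFun.meshNorm N u + MeshFun.meshNorm N w) := by
  have hu := meshNorm_nonneg N u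
  have hw := meshNorm_nonneg N w
  have h : MeshFun.meshNorm N (u + w) ^ 2 ≤
      2 * MeshFun.meshNorm N u ^ 2 + 2 * MeshFun.meshNorm N w ^ 2 := by
    simp only [meshNorm_sq]
    rw [mul_left_comm, mul_left_comm 2, ← mul_add]
    refine mul_le_mul_of_nonneg_left ?_ (by positivity)
    simp only [Finset.mul_sum, ← Finset.sum_add_distrib]
    refine Finset.sum_le_sum fun i _ => Finset.sum_le_sum fun j _ => Finset.sum_le_sum fun ξ _ => ?_
    have := norm_add_le (u (i, j) ξ) (w (i, j) ξ)
    simp only [Pi.add_apply]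
    nlinarith [norm_nonneg (u (i, j) ξ + w (i, j) ξ), sq_nonneg (‖u (i, j) ξ‖ - ‖w (i, j) ξ‖)]
  nlinarith

lemma meshNorm_le_of_forall_le {N : ℕ} (hN : 0 < N) {u : MeshFun} {M : ℝ} (hM : 0 ≤ M)
    (hu : ∀ η ξ, ‖u η ξ‖ ≤ M) : MeshFun.meshNorm N u ≤ 3 * M := by
  have h : MeshFun.meshNorm N u ^ 2 ≤ 6 * M ^ 2 := by
    have hN' : (N : ℝ) ≠ 0 := by positivity
    rw [meshNorm_sq]
    calc _ ≤ (1 / (N : ℝ)) ^ 2 * ∑ i ∈ Finset.Icc (1 : ℤ) N, ∑ j ∈ Finset.Icc (1 : ℤ) N,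
          ∑ ξ : Fin 6, M ^ 2 := by
          gcongr
          exact hu _ _
      _ = 6 * M ^ 2 := by
        simp
        field_simp
  have := meshNorm_nonneg N u
  nlinarith

lemma norm_sq_eq_re_add_im (z : ℂ) : ‖z‖ ^ 2 = z.re ^ 2 + z.im ^ 2 := by
  rw [Complex.sq_norm, Complex.normSq_apply]; ring

/-- Stability of the scheme with a source term. -/
theorem meshNorm_le_of_hasDeriv {a b : ℝ} (ha : 0 ≤ a) (hb : 0 ≤ b) {N : ℕ} (hN : 0 < N)
    {e ρ : ℝ → MeshFun} {M δ : ℝ} (hM : 0 ≤ M) (hδ : 0 < δ)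
    (hper : ∀ t, 0 ≤ t → (e t).IsPeriodic N)
    (hder : ∀ t, 0 ≤ t → ∀ η ξ, HasDerivWithinAt (fun τ => e τ η ξ)
      (meshRate a b (1 / N) (e t) η ξ + ρ t η ξ) (Ici 0) t)
    (h0 : ∀ η ξ, ‖e 0 η ξ‖ ≤ M) (hρ : ∀ t, 0 ≤ t → ∀ η ξ, ‖ρ t η ξ‖ ≤ δ) {t : ℝ} (ht : 0 ≤ t) :
    MeshFun.meshNorm N (e t) ≤ 7 * (M + δ * t) := by
  have hN' : (0 : ℝ) < N := by positivity
  have hinit {w : ℤ × ℤ → Fin 6 → ℝ} (hw : ∀ η ξ, |w η ξ| ≤ M) :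
      √(totalEnergy N w) ≤ 8 * N * M := by
    rw [Real.sqrt_le_left (by positivity)]
    refine (totalEnergy_le hw).trans ?_
    nlinarith [sq_nonneg (N * M)]
  have hre := sqrt_totalEnergy_le ha hb hN (e := fun t η ξ => (e t η ξ).re)
    (ρ := fun t η ξ => (ρ t η ξ).re) hδ
    (fun t ht η => by simp only [(hper t ht η).1, (hper t ht η).2, and_self])
    (fun t ht η ξ => by
      have := (Complex.reCLM.hasFDerivAt.comp_hasDerivWithinAt t (hder t ht η ξ))
      refine this.congr_deriv ?_
      rw [Complex.reCLM_apply, Complex.add_re, re_meshRate])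
    (fun t ht η ξ => (Complex.abs_re_le_norm _).trans (hρ t ht η ξ)) ht
  have him := sqrt_totalEnergy_le ha hb hN (e := fun t η ξ => (e t η ξ).im)
    (ρ := fun t η ξ => (ρ t η ξ).im) hδ
    (fun t ht η => by simp only [(hper t ht η).1, (hper t ht η).2, and_self])
    (fun t ht η ξ => by
      have := (Complex.imCLM.hasFDerivAt.comp_hasDerivWithinAt t (hder t ht η ξ))
      refine this.congr_deriv ?_
      rw [Complex.imCLM_apply, Complex.add_im, im_meshRate])
    (fun t ht η ξ => (Complex.abs_im_le_norm _).trans (hρ t ht η ξ)) ht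
  have hre0 := hinit fun η ξ => (Complex.abs_re_le_norm _).trans (h0 η ξ)
  have him0 := hinit fun η ξ => (Complex.abs_im_le_norm _).trans (h0 η ξ)
  set R : ℝ := 8 * N * (M + δ * t) with hR
  have hR0 : 0 ≤ R := by positivity
  have hre' := (Real.sqrt_le_left hR0).1 (hre.trans (by rw [hR]; linarith))
  have him' := (Real.sqrt_le_left hR0).1 (him.trans (by rw [hR]; linarith))
  have hsum : ∑ i ∈ Finset.Icc (1 : ℤ) N, ∑ j ∈ Finset.Icc (1 : ℤ) N,
      3 * ∑ ξ : Fin 6, ‖e t (i, j) ξ‖ ^ 2 ≤ 2 * R ^ 2 := by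
    have : ∑ i ∈ Finset.Icc (1 : ℤ) N, ∑ j ∈ Finset.Icc (1 : ℤ) N,
      3 * ∑ ξ : Fin 6, ‖e t (i, j) ξ‖ ^ 2 ≤ totalEnergy N (fun η ξ => (e t η ξ).re) +
        totalEnergy N (fun η ξ => (e t η ξ).im) := by
      simp only [totalEnergy, ← Finset.sum_add_distrib]
      refine Finset.sum_le_sum fun i _ => Finset.sum_le_sum fun j _ => ?_
      have h₁ := three_mul_sum_sq_le_energyForm fun ξ => (e t (i, j) ξ).re
      have h₂ := three_mul_sum_sq_le_energyForm fun ξ => (e t (i, j) ξ).im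
      simp only [norm_sq_eq_re_add_im, Finset.sum_add_distrib]
      linarith
    linarith
  simp only [← Finset.mul_sum] at hsum
  refine abs_le_of_sq_le_sq' ?_ (by positivity) |>.2
  rw [meshNorm_sq, div_pow, one_pow, one_div, inv_mul_le_iff₀ (by positivity)]
  rw [hR] at hsum
  -- The bound `2 R²` with `R = 8 N (M + δ t)` and the factor `3` on the left give `128 / 3`, which
  -- is below `7²`.
  nlinarith [sq_nonneg (N * (M + δ * t))]

lemma meshRate_sub (a b h : ℝ) (u w : MeshFun) :
    meshRate a b h (u - w) = meshRate a b h u - meshRate a b h w := by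
  funext η ξ
  simp only [meshRate, Pi.sub_apply, ← mul_sub]
  congr 1
  fin_cases ξ <;> simp [cellRate] <;> ring

lemma MeshFun.IsPeriodic.sub {N : ℕ} {u w : MeshFun} (hu : u.IsPeriodic N)
    (hw : w.IsPeriodic N) : (u - w).IsPeriodic N := fun η => by
  simp only [Pi.sub_apply, (hu η).1, (hu η).2, (hw η).1, (hw η).2, and_self]

lemma MeshFun.IsPeriodic.apply_eq {N : ℕ} {u : MeshFun} (hu : u.IsPeriodic N) (m n i j : ℤ) :
    u (m + i * N, n + j * N) = u (m, n) := by
  have h₁ : Function.Periodic (fun m => u (m, n + j * N)) (N : ℤ) := fun m => (hu (m, _)).1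
  have h₂ : Function.Periodic (fun n => u (m, n)) (N : ℤ) := fun n => (hu (_, n)).2
  have := h₁.int_mul i m
  have := h₂.int_mul j n
  simp_all

lemma MeshFun.IsPeriodic.exists_mem_Icc {N : ℕ} (hN : 0 < N) {u : MeshFun} (hu : u.IsPeriodic N)
    (η : ℤ × ℤ) : ∃ i ∈ Finset.Icc (1 : ℤ) N, ∃ j ∈ Finset.Icc (1 : ℤ) N, u η = u (i, j) := by
  have key (m : ℤ) : ∃ i ∈ Finset.Icc (1 : ℤ) N, ∃ k : ℤ, m = i + k * N := by
    have h₁ := Int.emod_nonneg (m - 1) (b := N) (by omega)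
    have h₂ := Int.emod_lt_of_pos (m - 1) (b := N) (by omega)
    have h₃ := Int.emod_add_mul_ediv (m - 1) N
    refine ⟨(m - 1) % N + 1, Finset.mem_Icc.2 ⟨by omega, by omega⟩, (m - 1) / N, ?_⟩
    rw [mul_comm]; omega
  obtain ⟨i, hi, k, hk⟩ := key η.1
  obtain ⟨j, hj, l, hl⟩ := key η.2
  refine ⟨i, hi, j, hj, ?_⟩
  rw [← hu.apply_eq i j k l, ← hk, ← hl]

lemma MeshFun.IsPeriodic.eq_zero_of_meshNorm {N : ℕ} (hN : 0 < N) {u : MeshFun}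
    (hu : u.IsPeriodic N) (h : MeshFun.meshNorm N u = 0) : u = 0 := by
  have h' := meshNorm_sq N u
  have hN' : (0 : ℝ) < (1 / (N : ℝ)) ^ 2 := by positivity
  rw [h, zero_pow two_ne_zero, zero_eq_mul, or_iff_right hN'.ne', Finset.sum_eq_zero_iff_of_nonneg
    fun _ _ => by positivity] at h'
  funext η ξ
  obtain ⟨i, hi, j, hj, hη⟩ := hu.exists_mem_Icc hN η
  have h₁ := h' i hi
  rw [Finset.sum_eq_zero_iff_of_nonneg fun _ _ => by positivity] at h₁
  have h₂ := h₁ j hj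
  rw [Finset.sum_eq_zero_iff_of_nonneg fun _ _ => by positivity] at h₂
  have h₃ := h₂ ξ (Finset.mem_univ _)
  rw [hη]
  simpa using h₃

/-! ### Well-posedness -/

lemma exists_hasDerivAt_linear {X : Type*} [NormedAddCommGroup X] [NormedSpace ℂ X]
    [FiniteDimensional ℂ X] (A : X →ₗ[ℂ] X) (x₀ : X) :
    ∃ x : ℝ → X, x 0 = x₀ ∧ ∀ t, HasDerivAt x (A (x t)) t := by
  have : CompleteSpace X := FiniteDimensional.complete ℂ X
  set B : X →L[ℂ] X := LinearMap.toContinuousLinearMap A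
  refine ⟨fun t => NormedSpace.exp (t • B) x₀, by simp, fun t => ?_⟩
  exact ((ContinuousLinearMap.apply ℂ X x₀).restrictScalars ℝ).hasFDerivAt.comp_hasDerivAt t
    (hasDerivAt_exp_smul_const' (𝕂 := ℝ) B t)

/-- The right-hand side of the scheme on a periodic mesh. -/
def torusRate (a b : ℝ) (N : ℕ) :
    (ZMod N × ZMod N → Fin 6 → ℂ) →ₗ[ℂ] (ZMod N × ZMod N → Fin 6 → ℂ) where
  toFun U θ := (((1 / N : ℝ) : ℂ)⁻¹) • cellRate (a : ℂ) (b : ℂ) (U θ) (U (θ.1 - 1, θ.2))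
    (U (θ.1, θ.2 - 1))
  map_add' U V := by
    funext θ
    simp only [Pi.add_apply, cellRate_add, smul_add]
  map_smul' c U := by
    funext θ
    simp only [Pi.smul_apply, cellRate_smul, RingHom.id_apply, smul_comm c]

/-- Periodic mesh functions are functions on `ZMod N × ZMod N`, a finite-dimensional space, on which
the linear system is solved by the exponential. -/
lemma exists_isSolution {a b : ℝ} (ha : 0 < a) (hb : 0 ≤ b) {s : EdgeFamily → Fin 2 → ℝ}
    (hs : ∀ E, s E 0 ≠ s E 1) {N : ℕ} (hN : 0 < N) {u₀ : MeshFun} (hu₀ : u₀.IsPeriodic N) :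
    ∃ u : ℝ → MeshFun, IsSolution (a, b) s N u ∧ u 0 = u₀ := by
  have : NeZero N := ⟨hN.ne'⟩
  obtain ⟨U, hU0, hU⟩ := exists_hasDerivAt_linear (torusRate a b N)
    fun θ => u₀ ((θ.1.val : ℤ), (θ.2.val : ℤ))
  refine ⟨fun t η => U t (η.1, η.2), (isSolution_iff ha hb hs hN).2 fun t ht =>
    ⟨fun η => by simp, fun η ξ => ?_⟩, ?_⟩
  · have h := hasDerivAt_pi.1 (hasDerivAt_pi.1 (hU t) (η.1, η.2)) ξ
    refine h.hasDerivWithinAt.congr_deriv ?_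
    simp [torusRate, meshRate]
  · funext η
    change U 0 _ = _
    rw [hU0]
    simp only [ZMod.val_intCast]
    rw [← hu₀.apply_eq (η.1 % N) (η.2 % N) (η.1 / N) (η.2 / N)]
    simp only [Int.emod_add_ediv_mul]

theorem isWellPosed {a b : ℝ} (ha : 0 < a) (hb : 0 ≤ b) {s : EdgeFamily → Fin 2 → ℝ}
    (hs : ∀ E, s E 0 ≠ s E 1) : IsWellPosed (a, b) s := by
  refine fun N hN u₀ hu₀ => ⟨exists_isSolution ha hb hs hN hu₀, fun u w hu hw hu0 hw0 t ht => ?_⟩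
  rw [isSolution_iff ha hb hs hN] at hu hw
  have hle : MeshFun.meshNorm N (u t - w t) ≤ 0 := by
    refine le_of_forall_pos_le_add fun ε hε => ?_
    -- The difference has no source, but the stability estimate asks for a positive bound; this one
    -- contributes less than `ε` at the time `t`.
    have hδ : 0 < ε / (7 * (t + 1)) := by positivity
    have h := meshNorm_le_of_hasDeriv ha.le hb hN (e := fun t => u t - w t) (ρ := fun _ => 0)
      le_rfl hδ (fun t ht => (hu t ht).1.sub (hw t ht).1)
      (fun t ht η ξ => by
        simp only [meshRate_sub, Pi.zero_apply, add_zero]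
        exact ((hu t ht).2 η ξ).sub ((hw t ht).2 η ξ))
      (fun η ξ => by simp [hu0, hw0]) (fun t ht η ξ => by simpa using hδ.le) ht
    refine h.trans ?_
    have : 7 * (0 + ε / (7 * (t + 1)) * t) = ε * (t / (t + 1)) := by field_simp; ring
    rw [this, zero_add]
    exact mul_le_of_le_one_right hε.le ((div_le_one (by positivity)).2 (by linarith))
  exact sub_eq_zero.1 (((hu t ht).1.sub (hw t ht).1).eq_zero_of_meshNorm hN
    (le_antisymm hle (meshNorm_nonneg _ _)))

/-! ### Partial derivatives and Taylor's formula in the plane -/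

/-- The partial derivative with respect to the first variable. -/
def dX (f : ℝ × ℝ → ℂ) (r : ℝ × ℝ) : ℂ := fderiv ℝ f r (1, 0)

/-- The partial derivative with respect to the second variable. -/
def dY (f : ℝ × ℝ → ℂ) (r : ℝ × ℝ) : ℂ := fderiv ℝ f r (0, 1)

lemma contDiff_dX {f : ℝ × ℝ → ℂ} {n : ℕ} (hf : ContDiff ℝ (n + 1 : ℕ) f) :
    ContDiff ℝ n (dX f) :=
  (hf.fderiv_right (m := n) (by norm_cast)).clm_apply contDiff_const

lemma contDiff_dY {f : ℝ × ℝ → ℂ} {n : ℕ} (hf : ContDiff ℝ (n + 1 : ℕ) f) :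
    ContDiff ℝ n (dY f) :=
  (hf.fderiv_right (m := n) (by norm_cast)).clm_apply contDiff_const

lemma fderiv_apply_eq (f : ℝ × ℝ → ℂ) (r q : ℝ × ℝ) :
    fderiv ℝ f r q = q.1 * dX f r + q.2 * dY f r := by
  have : q = q.1 • ((1, 0) : ℝ × ℝ) + q.2 • ((0, 1) : ℝ × ℝ) := by ext <;> simp
  conv_lhs => rw [this]
  simp [dX, dY, -Prod.smul_mk]

lemma dX_dY_comm {f : ℝ × ℝ → ℂ} (hf : ContDiff ℝ 2 f) (r : ℝ × ℝ) :
    dX (dY f) r = dY (dX f) r := by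
  have hd : DifferentiableAt ℝ (fderiv ℝ f) r :=
    (hf.fderiv_right (m := 1) (by norm_num)).differentiable (by norm_num) r
  have hs : IsSymmSndFDerivAt ℝ f r := hf.contDiffAt.isSymmSndFDerivAt (by simp)
  have h (q : ℝ × ℝ) : fderiv ℝ (fun x => fderiv ℝ f x q) r =
      (fderiv ℝ (fderiv ℝ f) r).flip q := by
    rw [fderiv_clm_apply hd (differentiableAt_const q)]
    simp
  change fderiv ℝ (fun x => fderiv ℝ f x (0, 1)) r (1, 0) =
    fderiv ℝ (fun x => fderiv ℝ f x (1, 0)) r (0, 1)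
  rw [h, h]
  exact hs _ _

lemma hasDerivAt_comp_line {f : ℝ × ℝ → ℂ} (hf : ContDiff ℝ 1 f) (p q : ℝ × ℝ) (τ : ℝ) :
    HasDerivAt (fun τ : ℝ => f (p + τ • q))
      (q.1 * dX f (p + τ • q) + q.2 * dY f (p + τ • q)) τ := by
  have h₁ : HasDerivAt (fun τ : ℝ => p + τ • q) q τ := by
    simpa using ((hasDerivAt_id τ).smul_const q).const_add p
  rw [← fderiv_apply_eq]
  exact ((hf.differentiable one_ne_zero) (p + τ • q)).hasFDerivAt.comp_hasDerivAt τ h₁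

/-- All partial derivatives of order `n` are bounded by `B`. -/
def PartialBound : ℕ → (ℝ × ℝ → ℂ) → ℝ → Prop
  | 0, f, B => ∀ r, ‖f r‖ ≤ B
  | n + 1, f, B => PartialBound n (dX f) B ∧ PartialBound n (dY f) B

lemma PartialBound.mono {n : ℕ} {f : ℝ × ℝ → ℂ} {B C : ℝ} (h : PartialBound n f B) (hBC : B ≤ C) :
    PartialBound n f C := by
  induction n generalizing f with
  | zero => exact fun r => (h r).trans hBC
  | succ n ih => exact ⟨ih h.1, ih h.2⟩

/-- Functions with the period `1` in each variable. -/
def IsOnePeriodic (f : ℝ × ℝ → ℂ) : Prop :=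
  ∀ r : ℝ × ℝ, f (r.1 + 1, r.2) = f r ∧ f (r.1, r.2 + 1) = f r

lemma IsOnePeriodic.fderiv_apply {f : ℝ × ℝ → ℂ} (hf : IsOnePeriodic f) (q : ℝ × ℝ) :
    IsOnePeriodic fun r => fderiv ℝ f r q := by
  intro r
  have h₁ : (fun x => f (x + (1, 0))) = f := by
    funext x; rw [← (hf x).1]; congr 1; ext <;> simp
  have h₂ : (fun x => f (x + (0, 1))) = f := by
    funext x; rw [← (hf x).2]; congr 1; ext <;> simp
  have e₁ := fderiv_comp_add_right (𝕜 := ℝ) (f := f) (x := r) (1, 0)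
  have e₂ := fderiv_comp_add_right (𝕜 := ℝ) (f := f) (x := r) (0, 1)
  rw [h₁] at e₁
  rw [h₂] at e₂
  constructor
  · change fderiv ℝ f (r.1 + 1, r.2) q = fderiv ℝ f r q
    rw [e₁]; congr 2; ext <;> simp
  · change fderiv ℝ f (r.1, r.2 + 1) q = fderiv ℝ f r q
    rw [e₂]; congr 2; ext <;> simp

lemma IsOnePeriodic.exists_bound {f : ℝ × ℝ → ℂ} (hf : IsOnePeriodic f) (hc : Continuous f) :
    ∃ B, 0 ≤ B ∧ ∀ r, ‖f r‖ ≤ B := by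
  obtain ⟨B, hB⟩ := (isCompact_Icc (a := ((0, 0) : ℝ × ℝ)) (b := (1, 1))).exists_bound_of_continuousOn
    hc.continuousOn
  refine ⟨B, (norm_nonneg _).trans (hB (0, 0) (by simp)), fun r => ?_⟩
  have h₁ : Function.Periodic (fun x => f (x, r.2)) 1 := fun x => (hf (x, _)).1
  have h₂ : Function.Periodic (fun y => f (Int.fract r.1, y)) 1 := fun y => (hf (_, y)).2
  have e₁ := h₁.sub_int_mul_eq ⌊r.1⌋ (x := r.1)
  have e₂ := h₂.sub_int_mul_eq ⌊r.2⌋ (x := r.2)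
  simp only [mul_one, Int.self_sub_floor] at e₁ e₂
  change ‖f (r.1, r.2)‖ ≤ B
  rw [← e₁, ← e₂]
  refine hB _ ⟨⟨Int.fract_nonneg _, Int.fract_nonneg _⟩,
    ⟨(Int.fract_lt_one _).le, (Int.fract_lt_one _).le⟩⟩

lemma IsOnePeriodic.exists_partialBound {n : ℕ} {f : ℝ × ℝ → ℂ} (hf : IsOnePeriodic f)
    (hc : ContDiff ℝ n f) : ∃ B, 0 ≤ B ∧ PartialBound n f B := by
  induction n generalizing f with
  | zero => exact hf.exists_bound hc.continuous
  | succ n ih =>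
    obtain ⟨B, hB, h⟩ := ih (hf.fderiv_apply (1, 0)) (contDiff_dX hc)
    obtain ⟨C, _, h'⟩ := ih (hf.fderiv_apply (0, 1)) (contDiff_dY hc)
    exact ⟨max B C, hB.trans (le_max_left _ _), h.mono (le_max_left _ _),
      h'.mono (le_max_right _ _)⟩

lemma norm_ofReal_mul_add_le {x y h C : ℝ} {z w : ℂ} (hx : |x| ≤ h) (hy : |y| ≤ h)
    (hz : ‖z‖ ≤ C) (hw : ‖w‖ ≤ C) : ‖x * z + y * w‖ ≤ 2 * C * h := by
  have hh : 0 ≤ h := (abs_nonneg x).trans hx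
  calc ‖x * z + y * w‖ ≤ ‖x * z‖ + ‖y * w‖ := norm_add_le _ _
    _ = |x| * ‖z‖ + |y| * ‖w‖ := by simp
    _ ≤ h * C + h * C := by gcongr
    _ = 2 * C * h := by ring

section Taylor

variable {f : ℝ × ℝ → ℂ} {B h : ℝ} {p q : ℝ × ℝ}

lemma norm_sub_le_of_partialBound (hf : ContDiff ℝ 1 f) (hB : PartialBound 1 f B)
    (h₁ : |q.1| ≤ h) (h₂ : |q.2| ≤ h) : ‖f (p + q) - f p‖ ≤ 2 * B * h := by
  have := norm_image_sub_le_of_norm_deriv_le_segment_01' (C := 2 * B * h)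
    (fun τ _ => (hasDerivAt_comp_line hf p q τ).hasDerivWithinAt)
    (fun τ _ => norm_ofReal_mul_add_le h₁ h₂ (hB.1 _) (hB.2 _))
  simpa using this

lemma abs_mul_le_of_mem {τ x : ℝ} (hτ : τ ∈ Ico (0 : ℝ) 1) (hx : |x| ≤ h) : |τ * x| ≤ h := by
  rw [abs_mul, abs_of_nonneg hτ.1]
  exact (mul_le_of_le_one_left (abs_nonneg x) hτ.2.le).trans hx

/-- Along the segment the derivative of the remainder is `q.1`, `q.2` times the remainders of `dX
f`, `dY f` of one order lower. Each order thus costs a factor `2 h`; the factorials are not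
exploited. The same induction step gives `taylor_two_of_partialBound`. -/
lemma taylor_one_of_partialBound (hf : ContDiff ℝ 2 f) (hB : PartialBound 2 f B)
    (h₁ : |q.1| ≤ h) (h₂ : |q.2| ≤ h) :
    ‖f (p + q) - (f p + q.1 * dX f p + q.2 * dY f p)‖ ≤ 4 * B * h ^ 2 := by
  have hX : ContDiff ℝ 1 (dX f) := contDiff_dX hf
  have hY : ContDiff ℝ 1 (dY f) := contDiff_dY hf
  have hd (τ : ℝ) := ((hasDerivAt_comp_line (hf.of_le (by norm_num)) p q τ).sub
    ((Complex.ofRealCLM.hasDerivAt (x := τ)).mul_const (q.1 * dX f p + q.2 * dY f p)))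
  have := norm_image_sub_le_of_norm_deriv_le_segment_01' (C := 4 * B * h ^ 2)
    (fun τ _ => (hd τ).hasDerivWithinAt) (fun τ hτ => ?_)
  · simp only [Complex.ofRealCLM_apply, one_smul, zero_smul, Pi.sub_apply, Complex.ofReal_one,
      Complex.ofReal_zero, one_mul, zero_mul, add_zero, sub_zero] at this
    refine le_trans (le_of_eq ?_) this
    congr 1
    ring
  · have hx := norm_sub_le_of_partialBound (p := p) (q := τ • q) hX hB.1
      (abs_mul_le_of_mem hτ h₁) (abs_mul_le_of_mem hτ h₂)
    have hy := norm_sub_le_of_partialBound (p := p) (q := τ • q) hY hB.2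
      (abs_mul_le_of_mem hτ h₁) (abs_mul_le_of_mem hτ h₂)
    have := norm_ofReal_mul_add_le h₁ h₂ hx hy
    refine le_trans (le_of_eq ?_) (this.trans (le_of_eq ?_))
    · congr 1
      simp
      ring
    · ring

lemma taylor_two_of_partialBound (hf : ContDiff ℝ 3 f) (hB : PartialBound 3 f B)
    (h₁ : |q.1| ≤ h) (h₂ : |q.2| ≤ h) :
    ‖f (p + q) - (f p + q.1 * dX f p + q.2 * dY f p + q.1 ^ 2 / 2 * dX (dX f) p +
      q.1 * q.2 * dY (dX f) p + q.2 ^ 2 / 2 * dY (dY f) p)‖ ≤ 8 * B * h ^ 3 := by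
  have hX : ContDiff ℝ 2 (dX f) := contDiff_dX hf
  have hY : ContDiff ℝ 2 (dY f) := contDiff_dY hf
  have hcomm := dX_dY_comm (hf.of_le (by norm_num)) p
  have hd (τ : ℝ) := ((hasDerivAt_comp_line (hf.of_le (by norm_num)) p q τ).sub
    ((Complex.ofRealCLM.hasDerivAt (x := τ)).mul_const (q.1 * dX f p + q.2 * dY f p))).sub
    (((Complex.ofRealCLM.hasDerivAt (x := τ)).pow 2).mul_const (q.1 ^ 2 / 2 * dX (dX f) p +
      q.1 * q.2 * dY (dX f) p + q.2 ^ 2 / 2 * dY (dY f) p))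
  have := norm_image_sub_le_of_norm_deriv_le_segment_01' (C := 8 * B * h ^ 3)
    (fun τ _ => (hd τ).hasDerivWithinAt) (fun τ hτ => ?_)
  · simp only [Complex.ofRealCLM_apply, one_smul, zero_smul, Pi.sub_apply, Complex.ofReal_one,
      Complex.ofReal_zero, one_mul, zero_mul, add_zero, sub_zero, Pi.pow_apply, one_pow,
      ne_eq, OfNat.ofNat_ne_zero, not_false_eq_true, zero_pow] at this
    refine le_trans (le_of_eq ?_) this
    congr 1
    ring
  · have hx := taylor_one_of_partialBound (p := p) (q := τ • q) hX hB.1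
      (abs_mul_le_of_mem hτ h₁) (abs_mul_le_of_mem hτ h₂)
    have hy := taylor_one_of_partialBound (p := p) (q := τ • q) hY hB.2
      (abs_mul_le_of_mem hτ h₁) (abs_mul_le_of_mem hτ h₂)
    rw [hcomm] at hy
    have := norm_ofReal_mul_add_le h₁ h₂ hx hy
    refine le_trans (le_of_eq ?_) (this.trans (le_of_eq ?_))
    · congr 1
      simp
      ring
    · ring

end Taylor

lemma hasDerivAt_exactSolution (ω : ℝ × ℝ) {f : ℝ × ℝ → ℂ} (hf : ContDiff ℝ 1 f) (r : ℝ × ℝ)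
    (t : ℝ) : HasDerivAt (fun t => exactSolution ω f t r)
      (-(ω.1 * exactSolution ω (dX f) t r + ω.2 * exactSolution ω (dY f) t r)) t := by
  have h := hasDerivAt_comp_line hf r (-ω) t
  have e (g : ℝ × ℝ → ℂ) (t : ℝ) : exactSolution ω g t r = g (r + t • (-ω)) := by
    simp only [exactSolution]
    congr 1
    ext <;> simp <;> ring
  simp only [e]
  refine h.congr_deriv ?_
  simp
  ring

/-! ### Consistency -/

/-- The correctors: for each monomial of degree two there is a cell-periodic mesh function that
balances the truncation error of the scheme on this monomial. -/
lemma exists_corrector {a b : ℝ} (ha : 0 < a) (hb : 0 < b) :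
    ∃ k₁ k₂ k₃ : Fin 6 → ℝ,
      cellRate a b k₁ k₁ k₁ = ![a / 2, -a / 2, a / 2, a / 2, -a / 2, -a / 2] ∧
      cellRate a b k₂ k₂ k₂ = ![0, -b, -a, b, 0, a] ∧
      cellRate a b k₃ k₃ k₃ = ![b / 2, b / 2, -b / 2, -b / 2, -b / 2, b / 2] := by
  -- Constants are annihilated, so component `0` is normalized to zero. The factor `b` in the
  -- denominators of `k₁` and `k₂` cannot be avoided: for `b = 0` the functional `φ` of
  -- `le_one_of_hasOrder` annihilates the left-hand side and takes the value `a` on the right-hand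
  -- side for `k₁`.
  refine ⟨![0, (11 * b + a) / (54 * (a + b)), a * (7 * b - a) / (54 * b * (a + b)),
      a * (7 * b - a) / (54 * b * (a + b)) - 2 * a / (9 * (a + b)),
      (a * (a * (7 * b - a) / (54 * b * (a + b))) + b * ((11 * b + a) / (54 * (a + b)))
        + a / (18 * (a + b)) * (a + 7 * b)) / (a + b),
      (11 * b + a) / (54 * (a + b)) + a / (9 * (a + b))],
    ![0, (b ^ 2 + 8 * a ^ 2) / (27 * a * (a + b)), (a ^ 2 + 8 * b ^ 2) / (27 * b * (a + b)),
      (a ^ 2 + 8 * b ^ 2) / (27 * b * (a + b)) - (2 * b - a) / (9 * (a + b)),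
      (a * ((a ^ 2 + 8 * b ^ 2) / (27 * b * (a + b)) - (2 * b - a) / (9 * (a + b))) +
        b * ((b ^ 2 + 8 * a ^ 2) / (27 * a * (a + b)) - (2 * a - b) / (9 * (a + b)))
        - 2 * (a + b) / 9) / (a + b),
      (b ^ 2 + 8 * a ^ 2) / (27 * a * (a + b)) - (2 * a - b) / (9 * (a + b))],
    ![0, b * (7 * a - b) / (54 * a * (a + b)), (11 * a + b) / (54 * (a + b)),
      (11 * a + b) / (54 * (a + b)) + b / (9 * (a + b)),
      (b * (b * (7 * a - b) / (54 * a * (a + b))) + a * ((11 * a + b) / (54 * (a + b)))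
        + b / (18 * (a + b)) * (b + 7 * a)) / (a + b),
      b * (7 * a - b) / (54 * a * (a + b)) - 2 * b / (9 * (a + b))], ?_, ?_, ?_⟩
  all_goals
    have := ha.ne'
    have := hb.ne'
    have := (add_pos ha hb).ne'
    funext ξ
    fin_cases ξ <;> simp [cellRate] <;> field_simp <;> ring

/-- Each component is a combination of at most six differences of size `2 M` with coefficients at
most `4 (a + b)`, and `6 · 4 · 2 = 48`. -/
lemma norm_cellRate_le {a b M : ℝ} (ha : 0 ≤ a) (hb : 0 ≤ b) {u l d : Fin 6 → ℂ}
    (hu : ∀ ξ, ‖u ξ‖ ≤ M) (hl : ∀ ξ, ‖l ξ‖ ≤ M) (hd : ∀ ξ, ‖d ξ‖ ≤ M) (ξ : Fin 6) :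
    ‖cellRate (a : ℂ) b u l d ξ‖ ≤ 48 * (a + b) * M := by
  have key (c : Fin 6 → ℝ) (z : Fin 6 → ℂ) (hc : ∀ i, |c i| ≤ 4 * (a + b))
      (hz : ∀ i, ‖z i‖ ≤ 2 * M) : ‖∑ i, (c i : ℂ) * z i‖ ≤ 48 * (a + b) * M := by
    calc ‖∑ i, (c i : ℂ) * z i‖ ≤ ∑ i : Fin 6, 4 * (a + b) * (2 * M) := by
          refine norm_sum_le_of_le _ fun i _ => ?_
          rw [norm_mul, Complex.norm_real, Real.norm_eq_abs]
          exact mul_le_mul (hc i) (hz i) (norm_nonneg _) (by positivity)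
      _ = 48 * (a + b) * M := by simp; ring
  have hsub {z w : ℂ} (hz : ‖z‖ ≤ M) (hw : ‖w‖ ≤ M) : ‖z - w‖ ≤ 2 * M :=
    (norm_sub_le z w).trans (by linarith)
  have hlow := key (z := ![u 1 - u 0, u 2 - u 0, l 5 - u 0, l 4 - u 2, d 3 - u 0, d 4 - u 1])
    (hz := fun i => by fin_cases i <;> simp [hsub, hu, hl, hd])
  have hupp := key (z := ![u 4 - u 3, u 4 - u 5, u 2 - u 3, u 1 - u 5, 0, 0])
    (hz := fun i => by
      have : 0 ≤ M := (norm_nonneg _).trans (hu 0)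
      fin_cases i <;> simp [hsub, hu, this])
  have habs {x c : ℝ} (h₁ : -c ≤ x) (h₂ : x ≤ c) : |x| ≤ c := abs_le.2 ⟨h₁, h₂⟩
  fin_cases ξ
  · refine le_trans (le_of_eq ?_) (hlow ![-a, -b, 4 * a, a, 4 * b, b] fun i => by
      fin_cases i <;> simp <;> apply habs <;> linarith)
    simp [cellRate, Fin.sum_univ_six]
    congr 1
  · refine le_trans (le_of_eq ?_) (hlow ![-a, -b, -2 * a, -2 * a, b, 4 * b] fun i => by
      fin_cases i <;> simp only <;> apply habs <;> simp <;> linarith)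
    simp [cellRate, Fin.sum_univ_six]
    congr 1
  · refine le_trans (le_of_eq ?_) (hlow ![-a, -b, a, 4 * a, -2 * b, -2 * b] fun i => by
      fin_cases i <;> simp only <;> apply habs <;> simp <;> linarith)
    simp [cellRate, Fin.sum_univ_six]
    congr 1
  · refine le_trans (le_of_eq ?_) (hupp ![-a, -b, 4 * (a + b), a + b, 0, 0] fun i => by
      fin_cases i <;> simp only <;> apply habs <;> simp <;> linarith)
    simp [cellRate, Fin.sum_univ_six]
    congr 1
  · refine le_trans (le_of_eq ?_) (hupp ![-a, -b, -2 * (a + b), -2 * (a + b), 0, 0] fun i => by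
      fin_cases i <;> simp only <;> apply habs <;> simp <;> linarith)
    simp [cellRate, Fin.sum_univ_six]
    congr 1
  · refine le_trans (le_of_eq ?_) (hupp ![-a, -b, a + b, 4 * (a + b), 0, 0] fun i => by
      fin_cases i <;> simp only <;> apply habs <;> simp <;> linarith)
    simp [cellRate, Fin.sum_univ_six]
    congr 1

lemma corner_mem (ξ : Fin 6) : 0 ≤ (corner ξ).1 ∧ (corner ξ).1 ≤ 1 ∧
    0 ≤ (corner ξ).2 ∧ (corner ξ).2 ≤ 1 := by
  fin_cases ξ <;> simp [corner]

/-- If the vertex values are close to `U`, `L`, `D`, for which the scheme is exact, then the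
truncation error is small. -/
lemma norm_truncation_le {a b h M ε : ℝ} (ha : 0 ≤ a) (hb : 0 ≤ b) (hh : 0 < h)
    {u l d U L D : Fin 6 → ℂ} {g G : ℂ} {ξ : Fin 6}
    (hu : ∀ ξ, ‖u ξ - U ξ‖ ≤ M) (hl : ∀ ξ, ‖l ξ - L ξ‖ ≤ M) (hd : ∀ ξ, ‖d ξ - D ξ‖ ≤ M)
    (hg : ‖g - G‖ ≤ ε) (hG : cellRate (a : ℂ) b U L D ξ = -h * G) :
    ‖-g - (h : ℂ)⁻¹ * cellRate (a : ℂ) b u l d ξ‖ ≤ ε + 48 * (a + b) * M / h := by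
  have hh' : (h : ℂ) ≠ 0 := by exact_mod_cast hh.ne'
  have hsplit : cellRate (a : ℂ) b u l d ξ =
      -h * G + cellRate (a : ℂ) b (u - U) (l - L) (d - D) ξ := by
    rw [← hG, ← Pi.add_apply, ← cellRate_add]
    simp
  have hc := norm_cellRate_le ha hb (u := u - U) (l := l - L) (d := d - D) hu hl hd ξ
  have : -g - (h : ℂ)⁻¹ * cellRate (a : ℂ) b u l d ξ =
      -(g - G) - (h : ℂ)⁻¹ * cellRate (a : ℂ) b (u - U) (l - L) (d - D) ξ := by
    rw [hsplit]
    field_simp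
    ring
  rw [this]
  refine (norm_sub_le _ _).trans ?_
  rw [norm_neg, norm_mul, norm_inv, Complex.norm_real, Real.norm_of_nonneg hh.le,
    div_eq_inv_mul]
  gcongr

lemma norm_mul_add_mul_le {a b C : ℝ} (ha : 0 ≤ a) (hb : 0 ≤ b) {z w : ℂ} (hz : ‖z‖ ≤ C)
    (hw : ‖w‖ ≤ C) : ‖a * z + b * w‖ ≤ (a + b) * C := by
  refine (norm_add_le _ _).trans ?_
  simp only [norm_mul, Complex.norm_real, Real.norm_of_nonneg ha, Real.norm_of_nonneg hb, add_mul]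
  gcongr

lemma abs_mul_corner_le {h σ : ℝ} (hh : 0 ≤ h) (hσ : σ = 0 ∨ σ = -1) {c : ℝ} (h₀ : 0 ≤ c)
    (h₁ : c ≤ 1) : |h * (σ + c)| ≤ h := by
  rw [abs_mul, abs_of_nonneg hh]
  refine mul_le_of_le_one_right hh (abs_le.2 ?_)
  rcases hσ with rfl | rfl <;> constructor <;> linarith

/-- The vertex values of `f` in the cell shifted by `σ`, where `p` is the position of the node
of the cell with `σ = 0`. -/
def vertexValues (f : ℝ × ℝ → ℂ) (h : ℝ) (p σ : ℝ × ℝ) (ξ : Fin 6) : ℂ :=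
  f (p + (h * (σ.1 + (corner ξ).1), h * (σ.2 + (corner ξ).2)))

/-- The rate reproduces `-ω · ∇` exactly on the first Taylor polynomial. Its remainder `4 B h²` is
amplified by `48 (a + b) / h`, and the variation of the gradient within the cell adds `2 (a + b) B
h`. -/
lemma norm_truncation_le_one {a b h B : ℝ} (ha : 0 ≤ a) (hb : 0 ≤ b) (hh : 0 < h)
    {f : ℝ × ℝ → ℂ} (hf : ContDiff ℝ 2 f) (hB : PartialBound 2 f B) (p : ℝ × ℝ) (ξ : Fin 6) :
    ‖-(a * vertexValues (dX f) h p 0 ξ + b * vertexValues (dY f) h p 0 ξ) -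
      (h : ℂ)⁻¹ * cellRate (a : ℂ) b (vertexValues f h p 0) (vertexValues f h p (-1, 0))
        (vertexValues f h p (0, -1)) ξ‖ ≤ 194 * (a + b) * B * h := by
  have hq {σ : ℝ × ℝ} (h₁ : σ.1 = 0 ∨ σ.1 = -1) (h₂ : σ.2 = 0 ∨ σ.2 = -1) (ξ : Fin 6) :=
    And.intro (abs_mul_corner_le hh.le h₁ (corner_mem ξ).1 (corner_mem ξ).2.1)
      (abs_mul_corner_le hh.le h₂ (corner_mem ξ).2.2.1 (corner_mem ξ).2.2.2)
  have hT {σ : ℝ × ℝ} (h₁ : σ.1 = 0 ∨ σ.1 = -1) (h₂ : σ.2 = 0 ∨ σ.2 = -1) (ξ : Fin 6) :=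
    taylor_one_of_partialBound (p := p)
      (q := (h * (σ.1 + (corner ξ).1), h * (σ.2 + (corner ξ).2))) hf hB (hq h₁ h₂ ξ).1 (hq h₁ h₂ ξ).2
  have hg : ‖(a * vertexValues (dX f) h p 0 ξ + b * vertexValues (dY f) h p 0 ξ) -
      (a * dX f p + b * dY f p)‖ ≤ (a + b) * (2 * B * h) := by
    have hq0 := hq (σ := 0) (.inl rfl) (.inl rfl) ξ
    refine le_trans (le_of_eq ?_) (norm_mul_add_mul_le ha hb
      (norm_sub_le_of_partialBound (p := p)
        (q := (h * ((0 : ℝ × ℝ).1 + (corner ξ).1), h * ((0 : ℝ × ℝ).2 + (corner ξ).2)))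
        (contDiff_dX hf) hB.1 hq0.1 hq0.2)
      (norm_sub_le_of_partialBound (p := p)
        (q := (h * ((0 : ℝ × ℝ).1 + (corner ξ).1), h * ((0 : ℝ × ℝ).2 + (corner ξ).2)))
        (contDiff_dY hf) hB.2 hq0.1 hq0.2))
    congr 1
    simp only [vertexValues]
    ring
  refine (norm_truncation_le ha hb hh (hT (σ := 0) (.inl rfl) (.inl rfl))
    (hT (σ := (-1, 0)) (.inr rfl) (.inl rfl)) (hT (σ := (0, -1)) (.inl rfl) (.inr rfl))
    hg ?_).trans (le_of_eq ?_)
  · fin_cases ξ <;> simp [cellRate, corner] <;> ring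
  · field_simp
    ring

/-- By `hfK` the term `h² K` cancels what the rate gets wrong on the second Taylor polynomial. What
remains is the cubic remainder and the variation of `K` between neighboring cells, both `O(h³)`
before the division by `h`, and the derivative of `h² K` along `ω`. -/
lemma norm_truncation_le_two {a b h B C : ℝ} (ha : 0 ≤ a) (hb : 0 ≤ b) (hh : 0 < h)
    {f : ℝ × ℝ → ℂ} (hf : ContDiff ℝ 3 f) (hB : PartialBound 3 f B) {K : Fin 6 → ℝ × ℝ → ℂ}
    (hK : ∀ ξ, ContDiff ℝ 1 (K ξ)) (hC : ∀ ξ, PartialBound 1 (K ξ) C)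
    (hfK : ∀ p ξ, cellRate (a : ℂ) b (fun ξ => K ξ p) (fun ξ => K ξ p) (fun ξ => K ξ p) ξ =
      ![a / 2, -a / 2, a / 2, a / 2, -a / 2, -a / 2] ξ * dX (dX f) p +
        ![0, -b, -a, b, 0, a] ξ * dY (dX f) p +
        ![b / 2, b / 2, -b / 2, -b / 2, -b / 2, b / 2] ξ * dY (dY f) p)
    (p : ℝ × ℝ) (ξ : Fin 6) :
    ‖-((a * vertexValues (dX f) h p 0 ξ + b * vertexValues (dY f) h p 0 ξ) +
        h ^ 2 * (a * dX (K ξ) p + b * dY (K ξ) p)) -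
      (h : ℂ)⁻¹ * cellRate (a : ℂ) b
        (fun ξ => vertexValues f h p 0 ξ + h ^ 2 * K ξ p)
        (fun ξ => vertexValues f h p (-1, 0) ξ + h ^ 2 * K ξ (p + (-h, 0)))
        (fun ξ => vertexValues f h p (0, -1) ξ + h ^ 2 * K ξ (p + (0, -h))) ξ‖ ≤
      (a + b) * (388 * B + 97 * C) * h ^ 2 := by
  have hq {σ : ℝ × ℝ} (h₁ : σ.1 = 0 ∨ σ.1 = -1) (h₂ : σ.2 = 0 ∨ σ.2 = -1) (ξ : Fin 6) :=
    And.intro (abs_mul_corner_le hh.le h₁ (corner_mem ξ).1 (corner_mem ξ).2.1)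
      (abs_mul_corner_le hh.le h₂ (corner_mem ξ).2.2.1 (corner_mem ξ).2.2.2)
  have hcomm := dX_dY_comm (hf.of_le (by norm_num)) p
  have hT {σ : ℝ × ℝ} (h₁ : σ.1 = 0 ∨ σ.1 = -1) (h₂ : σ.2 = 0 ∨ σ.2 = -1) {q : ℝ × ℝ}
      (hq₁ : |q.1| ≤ h) (hq₂ : |q.2| ≤ h) (ξ : Fin 6) :
      ‖(vertexValues f h p σ ξ + h ^ 2 * K ξ (p + q)) -
        ((f p + (h * (σ.1 + (corner ξ).1) : ℝ) * dX f p + (h * (σ.2 + (corner ξ).2) : ℝ) * dY f p +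
          (h * (σ.1 + (corner ξ).1) : ℝ) ^ 2 / 2 * dX (dX f) p +
          (h * (σ.1 + (corner ξ).1) : ℝ) * (h * (σ.2 + (corner ξ).2) : ℝ) * dY (dX f) p +
          (h * (σ.2 + (corner ξ).2) : ℝ) ^ 2 / 2 * dY (dY f) p) + h ^ 2 * K ξ p)‖ ≤
        (8 * B + 2 * C) * h ^ 3 := by
    have e₁ := taylor_two_of_partialBound (p := p)
      (q := (h * (σ.1 + (corner ξ).1), h * (σ.2 + (corner ξ).2))) hf hB (hq h₁ h₂ ξ).1 (hq h₁ h₂ ξ).2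
    have e₂ := norm_sub_le_of_partialBound (p := p) (hK ξ) (hC ξ) hq₁ hq₂
    rw [add_sub_add_comm, ← mul_sub]
    refine (norm_add_le _ _).trans ?_
    rw [norm_mul, norm_pow, Complex.norm_real, Real.norm_of_nonneg hh.le]
    have e₃ := mul_le_mul_of_nonneg_left e₂ (pow_nonneg hh.le 2)
    simp only [vertexValues]
    linarith
  have hg : ‖((a * vertexValues (dX f) h p 0 ξ + b * vertexValues (dY f) h p 0 ξ) +
      h ^ 2 * (a * dX (K ξ) p + b * dY (K ξ) p)) -
      (a * (dX f p + h * (corner ξ).1 * dX (dX f) p + h * (corner ξ).2 * dY (dX f) p) +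
        b * (dY f p + h * (corner ξ).1 * dY (dX f) p + h * (corner ξ).2 * dY (dY f) p))‖ ≤
      (a + b) * (4 * B * h ^ 2) + h ^ 2 * ((a + b) * C) := by
    have hq0 := hq (σ := 0) (.inl rfl) (.inl rfl) ξ
    have e₁ := norm_mul_add_mul_le ha hb
      (taylor_one_of_partialBound (p := p)
        (q := (h * ((0 : ℝ × ℝ).1 + (corner ξ).1), h * ((0 : ℝ × ℝ).2 + (corner ξ).2)))
        (contDiff_dX hf) hB.1 hq0.1 hq0.2)
      (taylor_one_of_partialBound (p := p)
        (q := (h * ((0 : ℝ × ℝ).1 + (corner ξ).1), h * ((0 : ℝ × ℝ).2 + (corner ξ).2)))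
        (contDiff_dY hf) hB.2 hq0.1 hq0.2)
    have e₂ := mul_le_mul_of_nonneg_left (norm_mul_add_mul_le ha hb ((hC ξ).1 p) ((hC ξ).2 p))
      (pow_nonneg hh.le 2)
    refine le_trans ?_ (add_le_add e₁ e₂)
    have e₃ : ‖(h : ℂ) ^ 2 * (a * dX (K ξ) p + b * dY (K ξ) p)‖ =
        h ^ 2 * ‖a * dX (K ξ) p + b * dY (K ξ) p‖ := by
      rw [norm_mul, norm_pow, Complex.norm_real, Real.norm_of_nonneg hh.le]
    rw [← e₃]
    refine le_trans (le_of_eq ?_) (norm_add_le _ _)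
    congr 1
    rw [hcomm]
    simp only [vertexValues]
    simp
    ring
  have hh0 : |(0 : ℝ)| ≤ h := by simpa using hh.le
  have hhn : |-h| ≤ h := by rw [abs_neg, abs_of_pos hh]
  have hT₀ := hT (σ := 0) (.inl rfl) (.inl rfl) (q := 0) hh0 hh0
  simp only [add_zero] at hT₀
  refine (norm_truncation_le ha hb hh hT₀ (hT (σ := (-1, 0)) (.inr rfl) (.inl rfl) hhn hh0)
    (hT (σ := (0, -1)) (.inl rfl) (.inr rfl) hh0 hhn) hg ?_).trans (le_of_eq ?_)
  · have hk := hfK p ξ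
    revert hk
    fin_cases ξ <;> simp [cellRate, corner] <;> intro hk <;> linear_combination h ^ 2 * hk
  · field_simp
    ring

/-! ### Convergence -/

/-- The position at the time `0` of the characteristic through the node of the cell `η`. -/
def characteristicFoot (ω : ℝ × ℝ) (h t : ℝ) (η : ℤ × ℤ) : ℝ × ℝ :=
  (η.1 * h - ω.1 * t, η.2 * h - ω.2 * t)

lemma exactSolution_cellPoint (ω : ℝ × ℝ) (h t : ℝ) (f : ℝ × ℝ → ℂ) (η : ℤ × ℤ) (ξ : Fin 6) :
    exactSolution ω f t (cellPoint h η (corner ξ)) =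
      vertexValues f h (characteristicFoot ω h t η) 0 ξ := by
  simp only [exactSolution, cellPoint, vertexValues, characteristicFoot]
  congr 1
  ext <;> simp <;> ring

lemma vertexValues_left (ω : ℝ × ℝ) (h t : ℝ) (f : ℝ × ℝ → ℂ) (η : ℤ × ℤ) (ξ : Fin 6) :
    vertexValues f h (characteristicFoot ω h t (η.1 - 1, η.2)) 0 ξ =
      vertexValues f h (characteristicFoot ω h t η) (-1, 0) ξ := by
  simp only [vertexValues, characteristicFoot]
  congr 1
  ext <;> simp
  ring

lemma vertexValues_below (ω : ℝ × ℝ) (h t : ℝ) (f : ℝ × ℝ → ℂ) (η : ℤ × ℤ) (ξ : Fin 6) :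
    vertexValues f h (characteristicFoot ω h t (η.1, η.2 - 1)) 0 ξ =
      vertexValues f h (characteristicFoot ω h t η) (0, -1) ξ := by
  simp only [vertexValues, characteristicFoot]
  congr 1
  ext <;> simp
  ring

lemma exactSolution_zero (ω : ℝ × ℝ) (f : ℝ × ℝ → ℂ) : exactSolution ω f 0 = f := by
  funext r
  simp [exactSolution]

lemma exactSolution_node (ω : ℝ × ℝ) (h t : ℝ) (f : ℝ × ℝ → ℂ) (η : ℤ × ℤ) :
    exactSolution ω f t (cellPoint h η 0) = f (characteristicFoot ω h t η) := by
  simp [exactSolution, cellPoint, characteristicFoot]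

lemma characteristicFoot_left (ω : ℝ × ℝ) (h t : ℝ) (η : ℤ × ℤ) :
    characteristicFoot ω h t (η.1 - 1, η.2) = characteristicFoot ω h t η + (-h, 0) := by
  ext <;> simp [characteristicFoot]
  ring

lemma characteristicFoot_below (ω : ℝ × ℝ) (h t : ℝ) (η : ℤ × ℤ) :
    characteristicFoot ω h t (η.1, η.2 - 1) = characteristicFoot ω h t η + (0, -h) := by
  ext <;> simp [characteristicFoot]
  ring

lemma IsOnePeriodic.exactSolution {f : ℝ × ℝ → ℂ} (hf : IsOnePeriodic f) (ω : ℝ × ℝ) (t : ℝ) :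
    IsOnePeriodic (exactSolution ω f t) := by
  intro r
  simp only [SDRT.exactSolution, add_sub_right_comm]
  exact hf (r.1 - ω.1 * t, r.2 - ω.2 * t)

lemma IsOnePeriodic.cellPoint {f : ℝ × ℝ → ℂ} (hf : IsOnePeriodic f) {N : ℕ} (hN : 0 < N)
    (η : ℤ × ℤ) (x : ℝ × ℝ) :
    f (cellPoint (1 / N) (η.1 + N, η.2) x) = f (cellPoint (1 / N) η x) ∧
      f (cellPoint (1 / N) (η.1, η.2 + N) x) = f (cellPoint (1 / N) η x) := by
  have hN' : (N : ℝ) ≠ 0 := by positivity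
  rw [← (hf (SDRT.cellPoint (1 / N) η x)).1]
  nth_rw 2 [(hf (SDRT.cellPoint (1 / N) η x)).1]
  rw [← (hf (SDRT.cellPoint (1 / N) η x)).2]
  constructor <;> congr 1 <;> ext <;> simp [SDRT.cellPoint] <;> field_simp <;> ring

/-- An approximate solution `w` that is close to `v` and has a small residual controls the error
of the scheme. -/
lemma meshNorm_error_le {a b : ℝ} (ha : 0 < a) (hb : 0 ≤ b) {s : EdgeFamily → Fin 2 → ℝ}
    (hs : ∀ E, s E 0 ≠ s E 1) {N : ℕ} (hN : 0 < N) {u v w w' : ℝ → MeshFun} {C D h : ℝ}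
    (hh : h = 1 / N)
    (hC : 0 < C) (hD : 0 ≤ D) (hu : IsSolution (a, b) s N u) (h0 : u 0 = v 0)
    (hw : ∀ t, 0 ≤ t → (w t).IsPeriodic N)
    (hw' : ∀ t, 0 ≤ t → ∀ η ξ, HasDerivWithinAt (fun τ => w τ η ξ) (w' t η ξ) (Ici 0) t)
    (hres : ∀ t, 0 ≤ t → ∀ η ξ, ‖w' t η ξ - meshRate a b h (w t) η ξ‖ ≤ C)
    (hwv : ∀ t, 0 ≤ t → ∀ η ξ, ‖w t η ξ - v t η ξ‖ ≤ D) {t : ℝ} (ht : 0 ≤ t) :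
    MeshFun.meshNorm N (u t - v t) ≤ 20 * D + 14 * C * t := by
  subst hh
  rw [isSolution_iff ha hb hs hN] at hu
  have h₁ := meshNorm_le_of_hasDeriv ha.le hb hN (e := fun t => u t - w t)
    (ρ := fun t => meshRate a b (1 / N) (w t) - w' t) hD hC
    (fun t ht => (hu t ht).1.sub (hw t ht))
    (fun t ht η ξ => by
      refine (((hu t ht).2 η ξ).sub (hw' t ht η ξ)).congr_deriv ?_
      simp [meshRate_sub])
    (fun η ξ => by
      rw [h0, Pi.sub_apply, Pi.sub_apply, norm_sub_rev]
      exact hwv 0 le_rfl η ξ)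
    (fun t ht η ξ => by
      rw [Pi.sub_apply, Pi.sub_apply, norm_sub_rev]
      exact hres t ht η ξ) ht
  have h₂ := meshNorm_le_of_forall_le hN hD (u := w t - v t) (hwv t ht)
  have h₃ := meshNorm_add_le N (u t - w t) (w t - v t)
  rw [sub_add_sub_cancel] at h₃
  linarith

theorem hasOrder_one {a b : ℝ} (ha : 0 < a) (hb : 0 ≤ b) {s : EdgeFamily → Fin 2 → ℝ}
    (hs : ∀ E, s E 0 ≠ s E 1) : HasOrder (a, b) s 1 := by
  intro f hf hper
  have hf' : ContDiff ℝ 2 f := by simpa using hf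
  replace hper : IsOnePeriodic f := hper
  obtain ⟨B, hB0, hB⟩ := hper.exists_partialBound (n := 2) hf'
  -- The summand `1` keeps the residual bound positive, as `meshNorm_error_le` requires; `B` may
  -- vanish.
  refine ⟨0, 14 * (194 * (a + b) * B + 1), fun N hN u hu h0 t ht => ?_⟩
  have hh : (0 : ℝ) < 1 / N := by positivity
  set h : ℝ := 1 / N with hdef
  have key := meshNorm_error_le ha hb hs hN hdef
    (v := fun t => lagrange h (exactSolution (a, b) f t))
    (w := fun t η ξ => exactSolution (a, b) f t (cellPoint h η (corner ξ)))
    (w' := fun t η ξ => -(a * exactSolution (a, b) (dX f) t (cellPoint h η (corner ξ)) +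
      b * exactSolution (a, b) (dY f) t (cellPoint h η (corner ξ))))
    (C := (194 * (a + b) * B + 1) * h) (D := 0) (by positivity) le_rfl hu
    (by simp only [h0, exactSolution_zero])
    (fun t ht η => ⟨funext fun ξ => ((hper.exactSolution (a, b) t).cellPoint hN η _).1,
      funext fun ξ => ((hper.exactSolution (a, b) t).cellPoint hN η _).2⟩)
    (fun t ht η ξ => (hasDerivAt_exactSolution (a, b) (hf'.of_le (by norm_num)) _ t).hasDerivWithinAt)
    (fun t ht η ξ => ?_) (fun t ht η ξ => by simp [lagrange]) ht
  · rw [Real.rpow_one]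
    linarith
  · have := norm_truncation_le_one ha.le hb hh hf' hB (characteristicFoot (a, b) h t η) ξ
    simp only [meshRate, exactSolution_cellPoint, vertexValues_left, vertexValues_below]
    refine le_trans this ?_
    linarith

theorem hasOrder_two {a b : ℝ} (ha : 0 < a) (hb : 0 < b) {s : EdgeFamily → Fin 2 → ℝ}
    (hs : ∀ E, s E 0 ≠ s E 1) : HasOrder (a, b) s 2 := by
  intro f hf hper
  have hf' : ContDiff ℝ 3 f := by simpa using hf
  replace hper : IsOnePeriodic f := hper
  obtain ⟨B, hB0, hB⟩ := hper.exists_partialBound (n := 3) hf'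
  obtain ⟨k₁, k₂, k₃, hk₁, hk₂, hk₃⟩ := exists_corrector ha hb
  set K : Fin 6 → ℝ × ℝ → ℂ := fun ξ p =>
    k₁ ξ * dX (dX f) p + k₂ ξ * dY (dX f) p + k₃ ξ * dY (dY f) p with hKdef
  have hXX : ContDiff ℝ 1 (dX (dX f)) := contDiff_dX (contDiff_dX hf')
  have hYX : ContDiff ℝ 1 (dY (dX f)) := contDiff_dY (contDiff_dX hf')
  have hYY : ContDiff ℝ 1 (dY (dY f)) := contDiff_dY (contDiff_dY hf')
  have hK (ξ : Fin 6) : ContDiff ℝ 1 (K ξ) :=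
    ((contDiff_const.mul hXX).add (contDiff_const.mul hYX)).add (contDiff_const.mul hYY)
  have hKper (ξ : Fin 6) : IsOnePeriodic (K ξ) := fun r => by
    have h₁ : dX (dX f) _ = _ ∧ dX (dX f) _ = _ :=
      (hper.fderiv_apply (1, 0)).fderiv_apply (1, 0) r
    have h₂ : dY (dX f) _ = _ ∧ dY (dX f) _ = _ :=
      (hper.fderiv_apply (1, 0)).fderiv_apply (0, 1) r
    have h₃ : dY (dY f) _ = _ ∧ dY (dY f) _ = _ :=
      (hper.fderiv_apply (0, 1)).fderiv_apply (0, 1) r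
    simp only [hKdef, h₁.1, h₁.2, h₂.1, h₂.2, h₃.1, h₃.2]
    exact ⟨rfl, rfl⟩
  choose C₀ hC₀ hC using fun ξ => (hKper ξ).exists_partialBound (n := 1) (hK ξ)
  choose D₀ hD₀ hD using fun ξ => (hKper ξ).exists_bound (hK ξ).continuous
  have hle {c : Fin 6 → ℝ} (hc : ∀ ξ, 0 ≤ c ξ) (ξ : Fin 6) : c ξ ≤ ∑ ξ, c ξ :=
    Finset.single_le_sum (fun ξ _ => hc ξ) (Finset.mem_univ ξ)
  set C := ∑ ξ, C₀ ξ with hCdef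
  set D := ∑ ξ, D₀ ξ with hDdef
  have hC0 : 0 ≤ C := Finset.sum_nonneg fun ξ _ => hC₀ ξ
  have hD0 : 0 ≤ D := Finset.sum_nonneg fun ξ _ => hD₀ ξ
  have hfK (p : ℝ × ℝ) (ξ : Fin 6) :
      cellRate (a : ℂ) b (fun ξ => K ξ p) (fun ξ => K ξ p) (fun ξ => K ξ p) ξ =
      ![a / 2, -a / 2, a / 2, a / 2, -a / 2, -a / 2] ξ * dX (dX f) p +
        ![0, -b, -a, b, 0, a] ξ * dY (dX f) p +
        ![b / 2, b / 2, -b / 2, -b / 2, -b / 2, b / 2] ξ * dY (dY f) p := by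
    have e₁ : ((cellRate a b k₁ k₁ k₁ ξ : ℝ) : ℂ) = _ := congrArg _ (congrFun hk₁ ξ)
    have e₂ : ((cellRate a b k₂ k₂ k₂ ξ : ℝ) : ℂ) = _ := congrArg _ (congrFun hk₂ ξ)
    have e₃ : ((cellRate a b k₃ k₃ k₃ ξ : ℝ) : ℂ) = _ := congrArg _ (congrFun hk₃ ξ)
    revert e₁ e₂ e₃
    fin_cases ξ <;> simp [cellRate, hKdef] <;> intro e₁ e₂ e₃ <;>
      linear_combination dX (dX f) p * e₁ + dY (dX f) p * e₂ + dY (dY f) p * e₃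
  refine ⟨20 * D, 14 * ((a + b) * (388 * B + 97 * C) + 1), fun N hN u hu h0 t ht => ?_⟩
  have hh : (0 : ℝ) < 1 / N := by positivity
  set h : ℝ := 1 / N with hdef
  -- The approximate solution is the interpolant plus `h²` times the corrector; the latter is
  -- sampled at the node of each cell, so that within a cell it depends on the vertex only through
  -- the index of `K`.
  have key := meshNorm_error_le ha hb.le hs hN hdef
    (v := fun t => lagrange h (exactSolution (a, b) f t))
    (w := fun t η ξ => exactSolution (a, b) f t (cellPoint h η (corner ξ)) +
      h ^ 2 * exactSolution (a, b) (K ξ) t (cellPoint h η 0))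
    (w' := fun t η ξ => -(a * exactSolution (a, b) (dX f) t (cellPoint h η (corner ξ)) +
      b * exactSolution (a, b) (dY f) t (cellPoint h η (corner ξ))) +
      h ^ 2 * -(a * exactSolution (a, b) (dX (K ξ)) t (cellPoint h η 0) +
      b * exactSolution (a, b) (dY (K ξ)) t (cellPoint h η 0)))
    (C := ((a + b) * (388 * B + 97 * C) + 1) * h ^ 2) (D := h ^ 2 * D) (by positivity)
    (by positivity) hu (by simp only [h0, exactSolution_zero])
    (fun t ht η => ?_)
    (fun t ht η ξ =>
      ((hasDerivAt_exactSolution (a, b) (hf'.of_le (by norm_num)) _ t).add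
        ((hasDerivAt_exactSolution (a, b) (hK ξ) _ t).const_mul _)).hasDerivWithinAt)
    (fun t ht η ξ => ?_) (fun t ht η ξ => ?_) ht
  · rw [Real.rpow_two]
    linarith
  · have hp := (hper.exactSolution (a, b) t).cellPoint hN η
    have hp' (ξ : Fin 6) := ((hKper ξ).exactSolution (a, b) t).cellPoint hN η 0
    exact ⟨funext fun ξ => by simp only [h, (hp (corner ξ)).1, (hp' ξ).1],
      funext fun ξ => by simp only [h, (hp (corner ξ)).2, (hp' ξ).2]⟩
  · have := norm_truncation_le_two ha.le hb.le hh hf' hB hK (fun ξ => (hC ξ).mono (hle hC₀ ξ)) hfK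
      (characteristicFoot (a, b) h t η) ξ
    simp only [meshRate, exactSolution_cellPoint, vertexValues_left, vertexValues_below,
      exactSolution_node]
    simp only [characteristicFoot_left, characteristicFoot_below]
    refine le_trans (le_of_eq ?_) (this.trans (by nlinarith [sq_nonneg h]))
    congr 1
    ring
  · simp only [lagrange, add_sub_cancel_left, norm_mul, norm_pow, Complex.norm_real,
      Real.norm_of_nonneg hh.le]
    gcongr
    exact (hD ξ _).trans (hle hD₀ ξ)

/-! ### Lower bounds for the error of a Fourier mode -/

/-- The Fourier mode `exp (2 π i x)` as a function of `x`. -/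
def wave (x : ℝ) : ℂ := Complex.exp ((2 * Real.pi * x : ℝ) * Complex.I)

lemma wave_add (x y : ℝ) : wave (x + y) = wave x * wave y := by
  rw [wave, wave, wave, ← Complex.exp_add]
  congr 1
  push_cast
  ring

lemma wave_zero : wave 0 = 1 := by simp [wave]

lemma norm_wave (x : ℝ) : ‖wave x‖ = 1 := Complex.norm_exp_ofReal_mul_I _

lemma wave_natCast (n : ℕ) : wave n = 1 := by
  rw [wave, Complex.exp_eq_one_iff]
  exact ⟨n, by push_cast; ring⟩

lemma wave_one : wave 1 = 1 := by simpa using wave_natCast 1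

lemma wave_neg_mul (x : ℝ) : wave (-x) * wave x = 1 := by
  rw [← wave_add, neg_add_cancel, wave_zero]

lemma contDiff_wave_fst {n : WithTop ℕ∞} : ContDiff ℝ n fun r : ℝ × ℝ => wave r.1 := by
  have : ContDiff ℝ n fun r : ℝ × ℝ => ((2 * Real.pi * r.1 : ℝ) : ℂ) :=
    Complex.ofRealCLM.contDiff.comp (contDiff_const.mul contDiff_fst)
  exact (this.mul contDiff_const).cexp

lemma hasDerivAt_wave_mul (a t : ℝ) :
    HasDerivAt (fun t => wave (a * t)) (2 * Real.pi * Complex.I * a * wave (a * t)) t := by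
  have h := ((((hasDerivAt_id t).const_mul a).const_mul (2 * Real.pi)).ofReal_comp.mul_const
    Complex.I).cexp
  refine h.congr_deriv ?_
  simp [wave]
  ring

lemma norm_one_sub_wave_le {x : ℝ} (hx : 0 ≤ x) : ‖wave x - 1‖ ≤ 2 * Real.pi * x := by
  have := Real.norm_exp_I_mul_ofReal_sub_one_le (x := 2 * Real.pi * x)
  rwa [mul_comm, Real.norm_of_nonneg (by positivity)] at this

lemma le_norm_wave_sub_one {x : ℝ} (hx : 0 ≤ x) (hx' : x ≤ 1 / 4) : 4 * x ≤ ‖wave x - 1‖ := by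
  have h₁ := Complex.abs_im_le_norm (wave x - 1)
  have h₂ : (wave x - 1).im = Real.sin (2 * Real.pi * x) := by
    rw [wave, Complex.sub_im, Complex.exp_ofReal_mul_I_im]
    simp
  have h₃ := Real.mul_le_sin (x := 2 * Real.pi * x) (by positivity)
    (by nlinarith [Real.pi_pos])
  have h₄ : 2 / Real.pi * (2 * Real.pi * x) = 4 * x := by
    have := Real.pi_ne_zero
    field_simp
    ring
  rw [h₂] at h₁
  rw [h₄] at h₃
  exact h₃.trans ((le_abs_self _).trans h₁)

/-- The real part is `1 - cos (2 π x) = 2 sin² (π x)`, and Jordan's inequality gives `sin (π x) ≥ 2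
x`. -/
lemma le_norm_wave_sub_one_sub {x : ℝ} (hx : 0 ≤ x) (hx' : x ≤ 1 / 4) :
    8 * x ^ 2 ≤ ‖2 * Real.pi * Complex.I * x - (wave x - 1)‖ := by
  have h₁ := Complex.abs_re_le_norm (2 * Real.pi * Complex.I * x - (wave x - 1))
  have h₂ : (2 * Real.pi * Complex.I * x - (wave x - 1)).re = 1 - Real.cos (2 * Real.pi * x) := by
    rw [wave, Complex.sub_re, Complex.sub_re, Complex.exp_ofReal_mul_I_re]
    simp
  have h₃ := Real.mul_le_sin (x := Real.pi * x) (by positivity) (by nlinarith [Real.pi_pos])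
  have h₄ : 2 / Real.pi * (Real.pi * x) = 2 * x := by
    have := Real.pi_ne_zero
    field_simp
  rw [h₂, mul_assoc, Real.cos_two_mul] at h₁
  rw [h₄] at h₃
  refine le_trans ?_ ((le_abs_self _).trans h₁)
  nlinarith [Real.sin_sq_add_cos_sq (Real.pi * x)]

/-- The right-hand side of the scheme for the amplitudes of the Fourier mode. -/
def modeRate (a b h : ℝ) : (Fin 6 → ℂ) →ₗ[ℂ] (Fin 6 → ℂ) where
  toFun X := (h : ℂ)⁻¹ • cellRate (a : ℂ) (b : ℂ) X (wave (-h) • X) X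
  map_add' X Y := by rw [smul_add, cellRate_add, smul_add]
  map_smul' c X := by rw [smul_comm _ c, cellRate_smul, smul_comm _ c, RingHom.id_apply]

/-- The amplitudes of the Fourier mode under the Lagrangian mapping. -/
def modeVertex (h : ℝ) (ξ : Fin 6) : ℂ := wave ((corner ξ).1 * h)

/-- The rate commutes with mesh translations, so the mode keeps its form. It does not depend on `y`,
so the cell below carries the same amplitudes and the cell on the left has the phase `wave (-h)`. -/
lemma exists_mode_solution {a b : ℝ} (ha : 0 < a) (hb : 0 ≤ b) {s : EdgeFamily → Fin 2 → ℝ}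
    (hs : ∀ E, s E 0 ≠ s E 1) {N : ℕ} (hN : 0 < N) :
    ∃ U : ℝ → Fin 6 → ℂ, U 0 = modeVertex (1 / N) ∧
      (∀ t, HasDerivAt U (modeRate a b (1 / N) (U t)) t) ∧
      IsSolution (a, b) s N fun t η ξ => wave (η.1 * (1 / N)) * U t ξ := by
  obtain ⟨U, hU0, hU⟩ := exists_hasDerivAt_linear (modeRate a b (1 / N)) (modeVertex (1 / N))
  have hN' : (N : ℝ) ≠ 0 := by positivity
  refine ⟨U, hU0, hU, (isSolution_iff ha hb hs hN).2 fun t ht => ⟨fun η => ?_, fun η ξ => ?_⟩⟩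
  · have : wave (((η.1 + N : ℤ) : ℝ) * (1 / N)) = wave (η.1 * (1 / N)) := by
      push_cast
      rw [add_mul, mul_one_div_cancel hN', wave_add, wave_one, mul_one]
    simp only [this, and_self]
  · refine ((hasDerivAt_pi.1 (hU t) ξ).const_mul _).hasDerivWithinAt.congr_deriv ?_
    have hl : (fun ξ => wave (((η.1 - 1 : ℤ) : ℝ) * (1 / N)) * U t ξ) =
        wave (η.1 * (1 / N)) • (wave (-(1 / N)) • U t) := by
      funext ξ
      simp only [Pi.smul_apply, smul_eq_mul, ← mul_assoc, ← wave_add]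
      congr 2
      push_cast
      ring
    simp only [meshRate, hl]
    change _ = _ * cellRate (a : ℂ) b (wave (η.1 * (1 / N)) • U t) _
      (wave (η.1 * (1 / N)) • U t) ξ
    rw [cellRate_smul]
    simp only [modeRate, LinearMap.coe_mk, AddHom.coe_mk, Pi.smul_apply, smul_eq_mul]
    ring

/-- Cells differ only by a phase, and the `N²` cells have the total weight `N² h² = 1`. -/
lemma norm_le_meshNorm {N : ℕ} (hN : 0 < N) {u : MeshFun} {X : Fin 6 → ℂ}
    (hu : ∀ η ξ, ‖u η ξ‖ = ‖X ξ‖) (ξ : Fin 6) : ‖X ξ‖ ≤ MeshFun.meshNorm N u := by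
  have hN' : (N : ℝ) ≠ 0 := by positivity
  refine abs_le_of_sq_le_sq' ?_ (meshNorm_nonneg _ _) |>.2
  rw [meshNorm_sq]
  simp only [hu]
  refine (Finset.single_le_sum (f := fun ξ => ‖X ξ‖ ^ 2) (fun _ _ => by positivity)
    (Finset.mem_univ ξ)).trans (le_of_eq ?_)
  simp
  field_simp

/-- The functional `φ` applied to the residual of the mode `X exp (2 π i (x - a t))`. -/
def modeResidual (a b h : ℝ) (φ X : Fin 6 → ℂ) : ℂ :=
  ∑ ξ, φ ξ * (2 * Real.pi * Complex.I * a * X ξ + modeRate a b h X ξ)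

lemma modeResidual_sub (a b h : ℝ) (φ X Y : Fin 6 → ℂ) :
    modeResidual a b h φ (X - Y) = modeResidual a b h φ X - modeResidual a b h φ Y := by
  simp only [modeResidual, map_sub, ← Finset.sum_sub_distrib, Pi.sub_apply]
  exact Finset.sum_congr rfl fun _ _ => by ring

/-- Seen along the characteristics, the exact mode is the constant vector `V = modeVertex h`, and
the numerical one, `W`, stays within `c h^q` of it for `t ≤ 1`. Since `φ(W)` has the derivative
`R(W) = R(V) + R(W - V)`, with `R` the residual functional, integration over `[0, 1]` bounds `R(V)`
by the change of `φ(W)` plus `κ` times the error. -/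
lemma norm_modeResidual_le_of_hasOrder {a b q : ℝ} (ha : 0 < a) (hb : 0 ≤ b)
    {s : EdgeFamily → Fin 2 → ℝ} (hs : ∀ E, s E 0 ≠ s E 1) (hq : HasOrder (a, b) s q) :
    ∃ c : ℝ, 0 ≤ c ∧ ∀ N : ℕ, 0 < N → ∀ (φ : Fin 6 → ℂ) (κ : ℝ), 0 ≤ κ →
      (∀ (X : Fin 6 → ℂ) (M : ℝ), (∀ ξ, ‖X ξ‖ ≤ M) → ‖modeResidual a b (1 / N) φ X‖ ≤ κ * M) →
      ‖modeResidual a b (1 / N) φ (modeVertex (1 / N))‖ ≤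
        c * (κ + ∑ ξ, ‖φ ξ‖) * (1 / (N : ℝ)) ^ q := by
  obtain ⟨c₁, c₂, H⟩ := hq (fun r => wave r.1) contDiff_wave_fst
    fun r => ⟨by rw [wave_add, wave_one, mul_one], rfl⟩
  refine ⟨|c₁| + |c₂|, by positivity, fun N hN φ κ hκ hφ => ?_⟩
  obtain ⟨U, hU0, hU, hsol⟩ := exists_mode_solution (b := b) ha hb hs hN
  set h : ℝ := 1 / N with hdef
  have hh : 0 < h := by positivity
  have H' := H N hN _ hsol (by
    funext η ξ
    simp only [hU0, modeVertex, ← wave_add, lagrange, cellPoint]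
    congr 1
    ring)
  set ε := (|c₁| + |c₂|) * h ^ q with hε
  set W : ℝ → Fin 6 → ℂ := fun t => wave (a * t) • U t with hW
  have hWε (t : ℝ) (ht : t ∈ Icc (0 : ℝ) 1) (ξ : Fin 6) : ‖W t ξ - modeVertex h ξ‖ ≤ ε := by
    have h₁ := norm_le_meshNorm hN (X := W t - modeVertex h) (u := (fun η ξ =>
      wave (η.1 * h) * U t ξ) - lagrange h (exactSolution (a, b) (fun r => wave r.1) t))
      (fun η ξ => by
        have : wave (η.1 * h) * U t ξ -
            wave ((η.1 + (corner ξ).1) * h - a * t) =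
            wave (η.1 * h) * wave (-(a * t)) * (wave (a * t) * U t ξ - modeVertex h ξ) := by
          rw [sub_eq_add_neg _ (a * t), add_mul (η.1 : ℝ), wave_add, wave_add, modeVertex]
          linear_combination -(wave (η.1 * h) * U t ξ * wave_neg_mul (a * t))
        simp only [Pi.sub_apply, lagrange, exactSolution, cellPoint, this, hW, norm_mul, norm_wave,
          one_mul, Pi.smul_apply, smul_eq_mul]) ξ
    refine h₁.trans ((H' t ht.1).trans ?_)
    rw [hε]
    gcongr
    · exact le_abs_self _
    · exact (mul_le_mul_of_nonneg_right (le_abs_self c₂) ht.1).trans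
        (mul_le_of_le_one_right (abs_nonneg _) ht.2)
  have hF (t : ℝ) : HasDerivAt (fun t => ∑ ξ, φ ξ * W t ξ) (modeResidual a b h φ (W t)) t := by
    have h₁ (ξ : Fin 6) := ((hasDerivAt_wave_mul a t).mul (hasDerivAt_pi.1 (hU t) ξ)).const_mul (φ ξ)
    refine (HasDerivAt.fun_sum fun ξ _ => h₁ ξ).congr_deriv ?_
    refine Finset.sum_congr rfl fun ξ _ => ?_
    simp only [hW, map_smul, Pi.smul_apply, smul_eq_mul]
    ring
  -- Mean value inequality for `φ(W(t)) - t R(V)`, whose derivative is `R(W - V)`.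
  have hmean := norm_image_sub_le_of_norm_deriv_le_segment_01' (C := κ * ε)
    (fun t _ => ((hF t).sub ((Complex.ofRealCLM.hasDerivAt (x := t)).mul_const
      (modeResidual a b h φ (modeVertex h)))).hasDerivWithinAt) (fun t ht => by
      have := hφ (W t - modeVertex h) ε (hWε t (Ico_subset_Icc_self ht))
      rw [modeResidual_sub] at this
      simpa using this)
  have hW0 : W 0 = modeVertex h := by simp [hW, hU0, wave_zero]
  have hend : ‖∑ ξ, φ ξ * W 1 ξ - ∑ ξ, φ ξ * W 0 ξ‖ ≤ (∑ ξ, ‖φ ξ‖) * ε := by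
    rw [← Finset.sum_sub_distrib, Finset.sum_mul]
    refine norm_sum_le_of_le _ fun ξ _ => ?_
    rw [← mul_sub, norm_mul, hW0]
    exact mul_le_mul_of_nonneg_left (hWε 1 (by simp) ξ) (norm_nonneg _)
  simp only [Pi.sub_apply, Complex.ofRealCLM_apply, Complex.ofReal_one, Complex.ofReal_zero,
    one_mul, zero_mul, sub_zero] at hmean
  have e : modeResidual a b h φ (modeVertex h) = (∑ ξ, φ ξ * W 1 ξ - ∑ ξ, φ ξ * W 0 ξ) -
      (∑ ξ, φ ξ * W 1 ξ - modeResidual a b h φ (modeVertex h) - ∑ ξ, φ ξ * W 0 ξ) := by ring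
  rw [e]
  refine (norm_sub_le _ _).trans ((add_le_add hend hmean).trans (le_of_eq ?_))
  rw [hε]
  ring

/-- The interpolant of a continuous function has no jumps, and this one is constant in `y`; only the
difference quotient in `x` survives. -/
lemma modeRate_modeVertex (a b h : ℝ) (ξ : Fin 6) :
    modeRate a b h (modeVertex h) ξ = -(h : ℂ)⁻¹ * (a * (wave h - 1)) := by
  have := wave_neg_mul h
  fin_cases ξ <;> simp [modeRate, cellRate, modeVertex, corner, wave_zero, this]

lemma le_of_forall_rpow_le {c C p q : ℝ} (hc : 0 < c)
    (H : ∀ N : ℕ, 4 ≤ N → c * (1 / (N : ℝ)) ^ p ≤ C * (1 / (N : ℝ)) ^ q) : q ≤ p := by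
  by_contra! hpq
  have hlim : Filter.Tendsto (fun N : ℕ => C * (N : ℝ) ^ (-(q - p))) Filter.atTop
      (nhds (C * 0)) :=
    ((tendsto_rpow_neg_atTop (sub_pos.2 hpq)).comp tendsto_natCast_atTop_atTop).const_mul C
  rw [mul_zero] at hlim
  refine hc.not_ge (ge_of_tendsto hlim (Filter.eventually_atTop.2 ⟨4, fun N hN => ?_⟩))
  have hN' : (0 : ℝ) < N := by positivity
  have hpos : (0 : ℝ) < (1 / (N : ℝ)) ^ p := by positivity
  refine le_of_mul_le_mul_right ((H N hN).trans (le_of_eq ?_)) hpos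
  rw [Real.rpow_neg hN'.le, ← Real.inv_rpow hN'.le, one_div, mul_assoc,
    ← Real.rpow_add (by positivity)]
  congr 2
  ring

lemma one_div_natCast_le {N : ℕ} (hN : 4 ≤ N) : (1 / (N : ℝ)) ≤ 1 / 4 := by
  gcongr
  exact_mod_cast hN

theorem le_two_of_hasOrder {a b q : ℝ} (ha : 0 < a) (hb : 0 ≤ b) {s : EdgeFamily → Fin 2 → ℝ}
    (hs : ∀ E, s E 0 ≠ s E 1) (hq : HasOrder (a, b) s q) : q ≤ 2 := by
  obtain ⟨c, hc, H⟩ := norm_modeResidual_le_of_hasOrder ha hb hs hq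
  set κ := 2 * Real.pi * a + 48 * (a + b) with hκ
  have hκ0 : 0 ≤ κ := by positivity
  refine le_of_forall_rpow_le (c := 8 * a) (C := c * (κ + 1)) (by positivity) fun N hN => ?_
  have hN0 : 0 < N := by omega
  have h4 := one_div_natCast_le hN
  have hh : (0 : ℝ) < 1 / N := by positivity
  -- Evaluation at one vertex: the rate costs `1/h`, so the truncation error of size `h` is only
  -- compared with `h^(q - 1)`.
  have HN := H N hN0 (Pi.single 0 1) (κ / (1 / N)) (by positivity)
  have hone : ∑ ξ : Fin 6, ‖(Pi.single 0 1 : Fin 6 → ℂ) ξ‖ = 1 := by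
    simp [Fin.sum_univ_six, Pi.single_apply]
  rw [hone] at HN
  set h : ℝ := 1 / N with hdef
  have hh' : (h : ℂ) ≠ 0 := by exact_mod_cast hh.ne'
  have hres (X : Fin 6 → ℂ) : modeResidual a b h (Pi.single 0 1) X =
      2 * Real.pi * Complex.I * a * X 0 + modeRate a b h X 0 := by
    simp [modeResidual, Pi.single_apply]
  simp only [hres] at HN
  have HN' := HN fun X M hX => by
    have hM : 0 ≤ M := (norm_nonneg _).trans (hX 0)
    have h₁ : ‖2 * Real.pi * Complex.I * a * X 0‖ ≤ 2 * Real.pi * a / h * M := by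
      simp only [norm_mul, Complex.norm_real, Complex.norm_I, Real.norm_of_nonneg ha.le,
        Real.norm_of_nonneg Real.pi_pos.le, Complex.norm_ofNat, mul_one]
      have : 2 * Real.pi * a ≤ 2 * Real.pi * a / h := by
        rw [le_div_iff₀ hh]
        exact mul_le_of_le_one_right (by positivity) (by linarith)
      exact mul_le_mul this (hX 0) (norm_nonneg _) (by positivity)
    have h₂ := norm_cellRate_le ha.le hb hX (l := wave (-h) • X) (fun ξ => by
      simpa [norm_wave] using hX ξ) hX 0
    have h₃ : ‖modeRate a b h X 0‖ ≤ 48 * (a + b) / h * M := by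
      change ‖(h : ℂ)⁻¹ * _‖ ≤ _
      rw [norm_mul, norm_inv, Complex.norm_real, Real.norm_of_nonneg hh.le]
      refine (mul_le_mul_of_nonneg_left h₂ (by positivity)).trans (le_of_eq ?_)
      ring
    refine (norm_add_le _ _).trans ((add_le_add h₁ h₃).trans (le_of_eq ?_))
    rw [hκ]
    ring
  have e : 2 * Real.pi * Complex.I * a * modeVertex h 0 + modeRate a b h (modeVertex h) 0 =
      (a : ℂ) / h * (2 * Real.pi * Complex.I * h - (wave h - 1)) := by
    rw [modeRate_modeVertex]
    simp only [modeVertex, corner, Matrix.cons_val_zero, zero_mul, wave_zero]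
    field_simp
    ring
  rw [e, norm_mul, norm_div, Complex.norm_real, Complex.norm_real, Real.norm_of_nonneg ha.le,
    Real.norm_of_nonneg hh.le] at HN'
  have hlow := mul_le_mul_of_nonneg_left (le_norm_wave_sub_one_sub hh.le h4)
    (div_nonneg ha.le hh.le)
  have hfin := mul_le_mul_of_nonneg_right (hlow.trans HN') hh.le
  have hpow : (0 : ℝ) ≤ h ^ q := by positivity
  calc 8 * a * h ^ (2 : ℝ) = a / h * (8 * h ^ 2) * h := by
        rw [Real.rpow_two]; field_simp
    _ ≤ c * (κ / h + 1) * h ^ q * h := hfin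
    _ = c * (κ + h) * h ^ q := by field_simp
    _ ≤ c * (κ + 1) * h ^ q := by gcongr; linarith

theorem le_one_of_hasOrder {a q : ℝ} (ha : 0 < a) {s : EdgeFamily → Fin 2 → ℝ}
    (hs : ∀ E, s E 0 ≠ s E 1) (hq : HasOrder (a, 0) s q) : q ≤ 1 := by
  obtain ⟨c, hc, H⟩ := norm_modeResidual_le_of_hasOrder ha le_rfl hs hq
  -- For `b = 0`, `φ` applied to `cellRate` gives `9 a ((l 4 - l 5) - (u 4 - u 5))`: a conservation
  -- law whose flux is the difference of the end values on a vertical edge. For the mode the flux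
  -- difference carries a factor `wave (-h) - 1`, which compensates the `1/h` in the rate and keeps
  -- `κ` bounded. The exact mode has zero flux, being constant in `y`, yet `φ` of it equals `1 -
  -- wave h`, of size `h`.
  set φ : Fin 6 → ℂ := ![-5, -5, 1, 5, 5, -1] with hφ
  have hsum : ∑ ξ : Fin 6, ‖φ ξ‖ = 22 := by
    simp [hφ, Fin.sum_univ_six]
    norm_num
  -- The term `2πia φ(X)` contributes `2πa · 22 = 44πa`, the flux term `9a · 2π · 2 = 36πa`.
  set κ := 80 * Real.pi * a with hκ
  refine le_of_forall_rpow_le (c := 8 * Real.pi * a) (C := c * (κ + 22)) (by positivity)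
    fun N hN => ?_
  have hN0 : 0 < N := by omega
  have h4 := one_div_natCast_le hN
  have hh : (0 : ℝ) < 1 / N := by positivity
  have HN := H N hN0 φ κ (by positivity)
  rw [hsum] at HN
  set h : ℝ := 1 / N with hdef
  have hh' : (h : ℂ) ≠ 0 := by exact_mod_cast hh.ne'
  have hres (X : Fin 6 → ℂ) : modeResidual a 0 h φ X =
      2 * Real.pi * Complex.I * a * ∑ ξ, φ ξ * X ξ +
        9 * a * ((h : ℂ)⁻¹ * (wave (-h) - 1)) * (X 4 - X 5) := by
    simp [modeResidual, Fin.sum_univ_six, hφ, modeRate, cellRate]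
    ring
  have HN' := HN fun X M hX => by
    have hM : 0 ≤ M := (norm_nonneg _).trans (hX 0)
    have h₁ : ‖∑ ξ, φ ξ * X ξ‖ ≤ 22 * M := by
      rw [← hsum, Finset.sum_mul]
      refine norm_sum_le_of_le _ fun ξ _ => ?_
      rw [norm_mul]
      exact mul_le_mul_of_nonneg_left (hX ξ) (norm_nonneg _)
    have h₂ : ‖(h : ℂ)⁻¹ * (wave (-h) - 1)‖ ≤ 2 * Real.pi := by
      have : wave (-h) - 1 = -(wave (-h) * (wave h - 1)) := by
        linear_combination wave_neg_mul h
      rw [this, norm_mul, norm_neg, norm_mul, norm_wave, one_mul, norm_inv, Complex.norm_real,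
        Real.norm_of_nonneg hh.le, inv_mul_le_iff₀ hh]
      exact (norm_one_sub_wave_le hh.le).trans (le_of_eq (by ring))
    have h₃ : ‖X 4 - X 5‖ ≤ 2 * M := (norm_sub_le _ _).trans (by linarith [hX 4, hX 5])
    rw [hres]
    refine (norm_add_le _ _).trans ?_
    have h₄ : ‖2 * Real.pi * Complex.I * a * ∑ ξ, φ ξ * X ξ‖ ≤ 2 * Real.pi * a * (22 * M) := by
      rw [norm_mul]
      refine mul_le_mul (le_of_eq ?_) h₁ (norm_nonneg _) (by positivity)
      simp [abs_of_pos ha, abs_of_pos Real.pi_pos]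
    have h₅ : ‖9 * a * ((h : ℂ)⁻¹ * (wave (-h) - 1)) * (X 4 - X 5)‖ ≤
        9 * a * (2 * Real.pi) * (2 * M) := by
      rw [norm_mul, norm_mul (9 * (a : ℂ))]
      refine mul_le_mul (mul_le_mul (le_of_eq ?_) h₂ (norm_nonneg _) (by positivity)) h₃
        (norm_nonneg _) (by positivity)
      simp [abs_of_pos ha]
    refine (add_le_add h₄ h₅).trans (le_of_eq ?_)
    rw [hκ]
    ring
  have e : modeResidual a 0 h φ (modeVertex h) = -(2 * Real.pi * Complex.I * a) * (wave h - 1) := by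
    rw [hres]
    simp [Fin.sum_univ_six, hφ, modeVertex, corner, wave_zero]
    ring
  have hn : ‖-(2 * Real.pi * Complex.I * (a : ℂ))‖ = 2 * Real.pi * a := by
    simp [abs_of_pos ha, abs_of_pos Real.pi_pos]
  rw [e, norm_mul, hn] at HN'
  have hlow := mul_le_mul_of_nonneg_left (le_norm_wave_sub_one hh.le h4)
    (show 0 ≤ 2 * Real.pi * a by positivity)
  rw [Real.rpow_one]
  linarith

end SDRT

end

theorem mainTheorem1 (ωx ωy : ℝ) (hx : 0 < ωx) (hy : 0 ≤ ωy)
    (s : SDRT.EdgeFamily → Fin 2 → ℝ)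
    (hs : ∀ E, s E 0 ≠ s E 1 ∧ ∀ i, s E i ∈ Set.Ioo (0 : ℝ) 1) :
    SDRT.IsWellPosed (ωx, ωy) s ∧
      (0 < ωy → SDRT.IsOptimalOrder (ωx, ωy) s 2) ∧
      (ωy = 0 → SDRT.IsOptimalOrder (ωx, ωy) s 1) := by
  have hs' (E : SDRT.EdgeFamily) : s E 0 ≠ s E 1 := (hs E).1
  refine ⟨SDRT.isWellPosed hx hy hs', fun hy' => ⟨⟨zero_le_two, SDRT.hasOrder_two hx hy' hs'⟩,
    fun q hq => SDRT.le_two_of_hasOrder hx hy hs' hq.2⟩, ?_⟩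
  rintro rfl
  exact ⟨⟨zero_le_one, SDRT.hasOrder_one hx le_rfl hs'⟩,
    fun q hq => SDRT.le_one_of_hasOrder hx hs' hq.2⟩
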